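/- Setting. Let $T$ be a finite tree with $n\ge 1$ vertices, and let $\rho>0$. Each edge $e$ has an interval $[w_e^-,w_e^+]$ with $0\le w_e^-\le w_e^+$. A scenario is a choice $s=(w^s_e)_e$ with $w^s_e\in[w^-_e,w^+_e]$; $C$ is the set of scenarios. Broadcasting follows the postal model: a vertex that has the message connects to its receivers one after another, each connection takes time $\rho$, and a receiver $b$ connected by $a$ gets the message $w^s_{a,b}$ time units after the connection is completed (meanwhile $a$ may serve further receivers). For a subtree $T'\ni u$, let $b^s(u,T')$ be the minimum time for $u$ to broadcast to all of $T'$. Let $r^s_{x,y}=b^s(x,T)-b^s(y,T)$. A scenario $s\in C$ is \emph{worst-case for $x$} if $r^s_{x,y}=\max\{r^{s'}_{x,y'} : s'\in C,\ y'\in V(T)\}$ for some $y$. For vertices $a\ne b$, let $O(a,b)$ be the component of $T-a$ containing $b$ (open branch), and $B(a,b)=T-O(a,b)$ (closed branch). A broadcast center under $s$ is a vertex minimizing $b^s(\cdot,T)$; such a vertex $k$ is \emph{prime} if moreover $b^s(k,B(k,u))\ge b^s(u,B(u,k))$ for all neighbours $u$ of $k$. Let $P_{x,y}$ be the edge set of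 the $x$-to-$y$ path, $d_{x,y}=|P_{x,y}|$, and $\tilde w^s_{x,y}=\sum_{e\in P_{x,y}}w^s_e$. Fix $x\in V(T)$ and $c\in C$. For $y\ne x$ the base scenario $\alpha_{x,y}$ has weight $w_e^+$ if $e\in P_{x,y}\cup E(B(y,x))$ and $w_e^-$ otherwise. For a scenario $s$ and a neighbour $v$ of $y$ put $f^s_y(v)=w^s_{y,v}+b^s(v,B(v,y))$. Let $h=h_y$ be the number of neighbours of $y$ in $B(y,x)$, and list them as $u_1,\dots,u_h$ ($u_k=u_{y,k}$) with $f^{\alpha_{x,y}}_y(u_k)$ nonincreasing in $k$ (ties broken arbitrarily). Let $E_k=\{(y,u_k)\}\cup E(B(u_k,y))$. For $1\le j\le h$, $\beta^j_{x,y}$ has weight $w_e^-$ if $e\in\bigcup_{j<k\le h}E_k$, and the weight of $\alpha_{x,y}$ otherwise. Let $\mathcal F=\{c\}\cup\{\beta^j_{x,y}: y\ne x,\ 1\le j\le h_y\}$. Claims. 1. (Finite family.) $\mathcal F$ is a finite set of scenarios, $|\mathcal F|\le n-1$ if $n\ge2$, and $\mathcal F$ contains a worst-case scenario for $x$. If $x$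 is a broadcast center under some worst-case scenario for $x$, then $c$ is worst-case for $x$. If $x$ is not a prime broadcast center under any worst-case scenario for $x$ (condition $(*)$), then some $\beta^j_{x,y}$ is worst-case for $x$, where $y\neq x$ is a prime broadcast center under some worst-case scenario for $x$. 2. (Criterion.) If $$d_{x,y}\,\rho+\tilde w^{\beta^j_{x,y}}_{x,y}+b^{\beta^j_{x,y}}(y,B(y,x))-b^{\beta^j_{x,y}}(y,T)$$ attains its maximum over all $y\ne x$ and $1\le j\le h_y$ at $(y',j')$, then $\beta^{j'}_{x,y'}$ is worst-case for $x$. 3. (Fact 1.) Let $s$ be worst-case for $x$, and let $y\ne x$ be a prime broadcast center under $s$. Let $s'$ agree with $\alpha_{x,y}$ on $P_{x,y}\cup E(O(y,x))$ and with $s$ on all other edges. Then $s'$ is worst-case for $x$, and $y$ is a broadcast center under $s'$. 4. (Fact 2.) Under $(*)$ there are a worst-case scenario $s$ for $x$ and a prime broadcast center $y\ne x$ under $s$ such that $s$ agrees with $\alpha_{x,y}$ on $P_{x,y}\cup E(O(y,x))$. 5. (Facts 3 and 4.) Assume $(*)$, and let $s,y$ be any pair as in 4. Let $\mu$ be the neighbour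 of $y$ in $O(y,x)$. For $0\le j\le h$, let $\gamma^j$ agree with $\alpha_{x,y}$ on $\bigcup_{1\le k\le j}E_k$ and with $s$ elsewhere. Let $Q_0$ be an arrangement of $u_1,\dots,u_h$ with $f^s_y$ nonincreasing. For $1\le j\le h$, let $Q_j$ arise from $Q_{j-1}$ by moving $u_j$ to position $j$ and shifting the entries from position $j$ up to just before the old position of $u_j$ one place to the right. Write $Q_j=(q_{j,1},\dots,q_{j,h})$, and let $\tau_j$ be the least $k$ with $b^{\gamma^j}(y,B(y,x))=k\rho+f_y^{\gamma^j}(q_{j,k})$. Then $\tau_0$ exists, and: - if $w^s_{y,\mu}+b^s(\mu,O(y,x))\ge f^s_y(q_{0,\tau_0})$, then $\beta^{h}_{x,y}$ is worst-case for $x$; - if $w^s_{y,\mu}+b^s(\mu,O(y,x))< f^s_y(q_{0,\tau_0})$, then there is a least $t^*\in\{1,\dots,h\}$ with $\tau_{t^*}=t^*$, and $\beta^{t^*}_{x,y}$ is worst-case for $x$. -/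

import Mathlib

namespace Broadcast

/-- A weight assignment to the edges of the graph `G`. -/
abbrev Weights {V : Type*} (G : SimpleGraph V) := G.edgeSet → ℝ

/-- The set `C` of scenarios: the product of the intervals `[lo e, hi e]` over all edges `e`. -/
def scenarios {V : Type*} {G : SimpleGraph V} (lo hi : Weights G) : Set (Weights G) :=
  {s | ∀ e, s e ∈ Set.Icc (lo e) (hi e)}

open Classical in
/-- The weight of the edge `(a, b)` under `s` (only used when `a` and `b` are adjacent). -/
noncomputable def wt {V : Type*} {G : SimpleGraph V} (s : Weights G) (a b : V) : ℝ :=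
  if h : G.Adj a b then s ⟨s(a, b), h⟩ else 0

/-- A broadcast schedule in the postal model on the subgraph of `G` induced by `S`, with source `u`.
Every vertex `v` of `S` other than `u` gets the message from a neighbour `par v` in `S`.
The sender `par v`, once it has the message, starts at time `call v` to connect to `v`; this takes
`ρ` time units, during which the sender cannot connect to another receiver. The message then
travels along the link for `wt s (par v) v` time units, and the sender is free in the meantime. -/
structure IsSchedule {V : Type*} {G : SimpleGraph V} (ρ : ℝ) (s : Weights G) (u : V) (S : Set V)
    (par : V → V) (call recv : V → ℝ) : Prop where
  source : recv u = 0
  par_mem : ∀ v ∈ S, v ≠ u → par v ∈ S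
  adj : ∀ v ∈ S, v ≠ u → G.Adj (par v) v
  informed : ∀ v ∈ S, v ≠ u → recv (par v) ≤ call v
  delivery : ∀ v ∈ S, v ≠ u → recv v = call v + ρ + wt s (par v) v
  sequential : ∀ v ∈ S, ∀ v' ∈ S, v ≠ u → v' ≠ u → v ≠ v' → par v = par v' →
    call v + ρ ≤ call v' ∨ call v' + ρ ≤ call v

/-- `b_time^s(u, S)`: the minimum time in which `u` can broadcast a message to all other vertices
of the subgraph induced by `S`. -/
noncomputable def bTime {V : Type*} {G : SimpleGraph V} (ρ : ℝ) (s : Weights G) (u : V)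
    (S : Set V) : ℝ :=
  sInf {t | ∃ (par : V → V) (call recv : V → ℝ),
    IsSchedule ρ s u S par call recv ∧ ∀ v ∈ S, recv v ≤ t}

/-- `v` is a broadcast center under `s`. -/
def IsCenter {V : Type*} {G : SimpleGraph V} (ρ : ℝ) (s : Weights G) (v : V) : Prop :=
  ∀ z, bTime ρ s v Set.univ ≤ bTime ρ s z Set.univ

/-- The relative regret `r^s_{x,y}`. -/
noncomputable def regret {V : Type*} {G : SimpleGraph V} (ρ : ℝ) (s : Weights G) (x y : V) : ℝ :=
  bTime ρ s x Set.univ - bTime ρ s y Set.univ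

/-- `s` is a worst-case scenario with respect to `x`: it is a scenario, and for some `y` the value
`r^s_{x,y}` is the maximum regret of `x`. -/
def IsWorstCase {V : Type*} {G : SimpleGraph V} (ρ : ℝ) (lo hi : Weights G) (x : V)
    (s : Weights G) : Prop :=
  s ∈ scenarios lo hi ∧
    ∃ y, IsGreatest {r | ∃ s' ∈ scenarios lo hi, ∃ y', r = regret ρ s' x y'} (regret ρ s x y)

/-- The vertex set of the open branch: the component of `G - x` that contains `y`. -/
def openBranch {V : Type*} (G : SimpleGraph V) (x y : V) : Set V :=
  {z | ∃ p : G.Walk y z, x ∉ p.support}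

/-- The vertex set of the closed branch: all vertices outside the open branch. -/
def closedBranch {V : Type*} (G : SimpleGraph V) (x y : V) : Set V :=
  (openBranch G x y)ᶜ

/-- `k` is a prime broadcast center under `s`. -/
def IsPrimeCenter {V : Type*} {G : SimpleGraph V} (ρ : ℝ) (s : Weights G) (k : V) : Prop :=
  IsCenter ρ s k ∧
    ∀ u, G.Adj k u → bTime ρ s u (closedBranch G u k) ≤ bTime ρ s k (closedBranch G k u)

/-- The set of edges with both endpoints in `S`. -/
def edgesIn {V : Type*} (G : SimpleGraph V) (S : Set V) : Set G.edgeSet :=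
  {e | ∀ v ∈ (e : Sym2 V), v ∈ S}

/-- The set `P_{x,y}` of edges on the `x`-to-`y` path (unique when `G` is a tree). -/
def pathEdges {V : Type*} (G : SimpleGraph V) (x y : V) : Set G.edgeSet :=
  {e | ∃ p : G.Walk x y, p.IsPath ∧ (e : Sym2 V) ∈ p.edges}

/-- The total weight of the edges on the `x`-to-`y` path. -/
noncomputable def pathWeight {V : Type*} {G : SimpleGraph V} (s : Weights G) (x y : V) : ℝ :=
  ∑ᶠ e ∈ pathEdges G x y, s e

open Classical in
/-- The base scenario `α_{x,y}`. -/
noncomputable def baseScenario {V : Type*} {G : SimpleGraph V} (lo hi : Weights G) (x y : V) :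
    Weights G :=
  fun e => if e ∈ pathEdges G x y ∪ edgesIn G (closedBranch G y x) then hi e else lo e

/-- The neighbours of `y` in the closed branch at `y` away from `x`. -/
def branchNbrs {V : Type*} (G : SimpleGraph V) (x y : V) : Set V :=
  {u | G.Adj y u ∧ u ∈ closedBranch G y x}

/-- The number `h` of neighbours of `y` in the closed branch at `y` away from `x`. -/
noncomputable def branchDeg {V : Type*} (G : SimpleGraph V) (x y : V) : ℕ :=
  (branchNbrs G x y).ncard

/-- For a neighbour `u` of `y`: the weight of `(y, u)` plus the time that `u` needs to broadcast
over its side of the edge `(y, u)`. -/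
noncomputable def branchValue {V : Type*} {G : SimpleGraph V} (ρ : ℝ) (s : Weights G)
    (y u : V) : ℝ :=
  wt s y u + bTime ρ s u (closedBranch G u y)

/-- `q 1, ..., q h` lists the neighbours of `y` in the closed branch at `y` away from `x`, each
once, in nonincreasing order of their branch values under `s`. -/
def IsSortedArrangement {V : Type*} {G : SimpleGraph V} (ρ : ℝ) (s : Weights G) (x y : V)
    (q : ℕ → V) : Prop :=
  Set.BijOn q (Set.Icc 1 (branchDeg G x y)) (branchNbrs G x y) ∧
    AntitoneOn (fun k => branchValue ρ s y (q k)) (Set.Icc 1 (branchDeg G x y))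

/-- The edge `(y, u)` together with the edges of the side of `u`. -/
def branchEdges {V : Type*} (G : SimpleGraph V) (y u : V) : Set G.edgeSet :=
  {e | (e : Sym2 V) = s(y, u) ∨ e ∈ edgesIn G (closedBranch G u y)}

open Classical in
/-- The modified base scenario `β^j_{x,y}`, for the arrangement `u 1, ..., u h`. -/
noncomputable def betaScenario {V : Type*} {G : SimpleGraph V} (lo hi : Weights G) (x y : V)
    (u : ℕ → V) (j : ℕ) : Weights G :=
  fun e => if ∃ k, j < k ∧ k ≤ branchDeg G x y ∧ e ∈ branchEdges G y (u k) then lo e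
    else baseScenario lo hi x y e

open Classical in
/-- The scenario `γ^j_{x,y}`, which starts from `γ^0 = s`. -/
noncomputable def gammaScenario {V : Type*} {G : SimpleGraph V} (lo hi : Weights G)
    (s : Weights G) (x y : V) (u : ℕ → V) (j : ℕ) : Weights G :=
  fun e => if ∃ k, 1 ≤ k ∧ k ≤ j ∧ e ∈ branchEdges G y (u k) then baseScenario lo hi x y e
    else s e

open Classical in
/-- The arrangements `Q_j`. To get `Q_{j+1}` from `Q_j`, the entry `u (j + 1)` is moved to position
`j + 1`, and the entries from there up to its old position go one place to the right. -/
noncomputable def shiftSeq {V : Type*} (h : ℕ) (u Q₀ : ℕ → V) : ℕ → ℕ → V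
  | 0 => Q₀
  | j + 1 => fun k =>
      if k ≤ j then shiftSeq h u Q₀ j k
      else if k = j + 1 then u (j + 1)
      else if ∃ l, k ≤ l ∧ l ≤ h ∧ shiftSeq h u Q₀ j l = u (j + 1) then shiftSeq h u Q₀ j (k - 1)
      else shiftSeq h u Q₀ j k

/-- `τ` is the first position in the sequence `q 1, ..., q h` whose branch determines the
broadcast time of `y` over the closed branch at `y` away from `x` under `s`. -/
def IsFirstCritical {V : Type*} {G : SimpleGraph V} (ρ : ℝ) (s : Weights G) (x y : V)
    (q : ℕ → V) (τ : ℕ) : Prop :=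
  IsLeast {k | k ∈ Set.Icc 1 (branchDeg G x y) ∧
    bTime ρ s y (closedBranch G y x) = k * ρ + branchValue ρ s y (q k)} τ

/-- `d_{x,y} ρ + w̃^s_{x,y} + b_time^s(y, closed branch at y away from x) - b_time^s(y, T)`. -/
noncomputable def criterion {V : Type*} {G : SimpleGraph V} (ρ : ℝ) (s : Weights G) (x y : V) :
    ℝ :=
  (pathEdges G x y).ncard * ρ + pathWeight s x y + bTime ρ s y (closedBranch G y x)
    - bTime ρ s y Set.univ

/-- The candidate family: an arbitrary scenario `c`, and all `β^j_{x,y}` with `y ≠ x`, `1 ≤ j ≤ h`,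
where `u y` is the chosen arrangement for `y`. -/
def candidates {V : Type*} {G : SimpleGraph V} (lo hi : Weights G) (x : V) (u : V → ℕ → V)
    (c : Weights G) : Set (Weights G) :=
  {s | s = c ∨ ∃ y, y ≠ x ∧ ∃ j ∈ Set.Icc 1 (branchDeg G x y), s = betaScenario lo hi x y (u y) j}

end Broadcast

/-!
A vertex that broadcasts over a set of branches with branch values `f (q 1) ≥ f (q 2) ≥ ...` needs
the time `max_k (k * ρ + f (q k))`, so broadcast times satisfy a recursion in the tree rooted at
`x`. The criterion is a lower bound for the regret, since `x` may send the message straight to `y`,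
and it equals the regret if `y` is a prime center. A scenario is therefore worst-case as soon as its
criterion at `y` is at least that of a worst-case scenario with prime center `y`.

Moving the weights on the path and on the open branch to those of the base scenario does not
decrease the criterion. If `y` is farthest from `x` among the prime centers of worst-case scenarios,
then after this move there is a prime center at `y` or at the neighbour of `y` towards `x`, and the
weights are those of the base scenario for it. It remains to treat the branches below `y`. If the
branch towards `x` is served no later than the critical ones, raising all branches below `y` adds at
least as much to the time over the closed branch as to the time over the tree. Otherwise this holds
for raising `u 1, ..., u t`, where `t` is the first index for which the branch of `u t` attains the
completion time of the closed branch at position `t`: these branches then all have values at least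
the critical level of the original scenario. Lowering the branches of `u (t + 1), u (t + 2), ...`
afterwards leaves the time over the closed branch unchanged and cannot increase the time over the
tree.
-/

namespace Broadcast

variable {V : Type*} {G : SimpleGraph V}

section Branches

/-- In the tree `G` rooted at `x`, the vertex `m` is the parent of `y`. The subtree that consists of
`y` and its descendants is then `closedBranch G y x`, which is the whole tree for `y = x`. -/
structure IsParent (G : SimpleGraph V) (x y m : V) : Prop where
  adj : G.Adj y m
  mem_openBranch : m ∈ openBranch G y x

lemma mem_closedBranch_self (a b : V) : a ∈ closedBranch G a b :=
  fun ⟨p, hp⟩ => hp p.end_mem_support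

lemma closedBranch_self (a : V) : closedBranch G a a = Set.univ :=
  Set.eq_univ_of_forall fun _ ⟨p, hp⟩ => hp p.start_mem_support

lemma openBranch_eq_of_mem {x y m : V} (h : m ∈ openBranch G y x) :
    openBranch G y x = openBranch G y m := by
  obtain ⟨p, hp⟩ := h
  ext z
  constructor
  · rintro ⟨q, hq⟩
    exact ⟨p.reverse.append q, by simp [hp, hq]⟩
  · rintro ⟨q, hq⟩
    exact ⟨p.append q, by simp [hp, hq]⟩

lemma IsParent.closedBranch_eq {x y m : V} (h : IsParent G x y m) :
    closedBranch G y x = closedBranch G y m := by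
  rw [closedBranch, closedBranch, openBranch_eq_of_mem h.mem_openBranch]

lemma eq_of_adj_of_mem_of_notMem_closedBranch {x v z w : V} (hz : z ∈ closedBranch G v x)
    (hw : w ∉ closedBranch G v x) (h : G.Adj z w) : z = v := by
  by_contra hne
  obtain ⟨p, hp⟩ := not_not.1 hw
  exact hz ⟨p.concat h.symm, by
    simpa [SimpleGraph.Walk.support_concat] using ⟨hp, Ne.symm hne⟩⟩

variable (hG : G.IsTree)
include hG

lemma mem_closedBranch_iff {a b z : V} :
    z ∈ closedBranch G a b ↔ G.dist b a + G.dist a z = G.dist b z := by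
  classical
  constructor
  · intro hz
    obtain ⟨p, -, hp⟩ := hG.connected.exists_path_of_dist b z
    have ha : a ∈ p.support := by
      by_contra ha
      exact hz ⟨p, ha⟩
    have hlength := congrArg SimpleGraph.Walk.length (p.take_spec ha)
    rw [SimpleGraph.Walk.length_append] at hlength
    have htake := SimpleGraph.dist_le (p.takeUntil a ha)
    have hdrop := SimpleGraph.dist_le (p.dropUntil a ha)
    have htriangle := hG.connected.dist_triangle (u := b) (v := a) (w := z)
    omega
  · rintro hdist ⟨p, hp⟩
    obtain ⟨q, -, hq⟩ := hG.connected.exists_path_of_dist b a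
    obtain ⟨r, -, hr⟩ := hG.connected.exists_path_of_dist a z
    have hpath : (q.append r).IsPath :=
      SimpleGraph.Walk.isPath_of_length_eq_dist _ (by rw [SimpleGraph.Walk.length_append]; omega)
    have hbypass : q.append r = p.bypass :=
      (hG.existsUnique_path b z).unique hpath p.bypass_isPath
    refine hp (p.support_bypass_subset_support ?_)
    rw [← hbypass, SimpleGraph.Walk.mem_support_append_iff]
    exact Or.inl q.end_mem_support

lemma mem_openBranch_iff {a b z : V} :
    z ∈ openBranch G a b ↔ G.dist b a + G.dist a z ≠ G.dist b z := by
  rw [Ne, ← mem_closedBranch_iff hG, closedBranch, Set.mem_compl_iff, not_not]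

lemma isParent_iff {x y m : V} :
    IsParent G x y m ↔ G.Adj y m ∧ G.dist x y = G.dist x m + 1 := by
  refine ⟨fun ⟨hadj, hmem⟩ => ⟨hadj, ?_⟩, fun ⟨hadj, _⟩ => ⟨hadj, ?_⟩⟩
  · rw [mem_openBranch_iff hG, SimpleGraph.dist_eq_one_iff_adj.2 hadj] at hmem
    have := hG.dist_eq_dist_add_one_of_adj x hadj
    omega
  · rw [mem_openBranch_iff hG, SimpleGraph.dist_eq_one_iff_adj.2 hadj]
    omega

lemma isParent_or_isParent_of_adj (x : V) {y m : V} (h : G.Adj y m) :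
    IsParent G x y m ∨ IsParent G x m y := by
  rw [isParent_iff hG, isParent_iff hG]
  exact (hG.dist_eq_dist_add_one_of_adj x h).imp (⟨h, ·⟩) (⟨h.symm, ·⟩)

lemma isParent_of_adj {y m : V} (h : G.Adj y m) : IsParent G m y m := by
  rw [isParent_iff hG, SimpleGraph.dist_self, SimpleGraph.dist_eq_one_iff_adj]
  exact ⟨h, h.symm⟩

lemma IsParent.notMem_support {x y m : V} (h : IsParent G x y m) {p : G.Walk x m}
    (hp : p.IsPath) : y ∉ p.support := by
  classical
  obtain ⟨q, hq⟩ := h.mem_openBranch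
  rw [(hG.existsUnique_path x m).unique hp q.bypass_isPath]
  exact fun hy => hq (q.support_bypass_subset_support hy)

lemma IsParent.isPath_concat {x y m : V} (h : IsParent G x y m) {p : G.Walk x m} (hp : p.IsPath) :
    (p.concat h.adj.symm).IsPath :=
  hp.concat (h.notMem_support hG hp) h.adj.symm

lemma IsParent.unique {x y v w : V} (hv : IsParent G x y v) (hw : IsParent G x y w) : v = w := by
  obtain ⟨p, hp, -⟩ := hG.existsUnique_path x v
  obtain ⟨q, hq, -⟩ := hG.existsUnique_path x w
  simpa using congrArg SimpleGraph.Walk.penultimate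
    ((hG.existsUnique_path x y).unique (hv.isPath_concat hG hp) (hw.isPath_concat hG hq))

lemma exists_isParent {x y : V} (h : y ≠ x) : ∃ m, IsParent G x y m := by
  obtain ⟨p, -, hp⟩ := hG.connected.exists_path_of_dist y x
  cases p with
  | nil => exact absurd rfl h
  | @cons _ m _ hadj q =>
    refine ⟨m, (isParent_or_isParent_of_adj hG x hadj).resolve_right fun hm => ?_⟩
    have hq := SimpleGraph.dist_le q
    rw [SimpleGraph.Walk.length_cons] at hp
    have hdist := ((isParent_iff hG).1 hm).2
    rw [G.dist_comm (u := x), G.dist_comm (u := x)] at hdist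
    omega

lemma IsParent.ne_root {x y m : V} (h : IsParent G x y m) : y ≠ x := by
  rintro rfl
  have := ((isParent_iff hG).1 h).2
  rw [SimpleGraph.dist_self] at this
  omega

lemma mem_branchNbrs_iff {x y v : V} : v ∈ branchNbrs G x y ↔ IsParent G x v y := by
  rw [isParent_iff hG, branchNbrs, Set.mem_ofPred_eq, G.adj_comm y]
  refine and_congr_right fun h => ?_
  rw [mem_closedBranch_iff hG, SimpleGraph.dist_eq_one_iff_adj.2 h.symm, eq_comm]

lemma mem_closedBranch_iff_isParent {a v z : V} (h : G.Adj a v) :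
    z ∈ closedBranch G v a ↔ IsParent G z a v := by
  rw [isParent_iff hG, mem_closedBranch_iff hG, SimpleGraph.dist_eq_one_iff_adj.2 h,
    G.dist_comm (u := v), G.dist_comm (u := a)]
  constructor
  · exact fun hdist => ⟨h, by omega⟩
  · rintro ⟨-, hdist⟩
    omega

lemma IsParent.openBranch_eq {x y m : V} (h : IsParent G x y m) :
    openBranch G y x = closedBranch G m y := by
  ext z
  rw [openBranch_eq_of_mem h.mem_openBranch, mem_closedBranch_iff_isParent hG h.adj,
    mem_openBranch_iff hG, isParent_iff hG, SimpleGraph.dist_eq_one_iff_adj.2 h.adj.symm,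
    G.dist_comm (u := z), G.dist_comm (u := z)]
  have := hG.dist_eq_dist_add_one_of_adj z h.adj
  rw [G.dist_comm (u := z), G.dist_comm (u := z)] at this
  refine ⟨fun hne => ⟨h.adj, by omega⟩, ?_⟩
  rintro ⟨-, hdist⟩
  omega

lemma closedBranch_subset_of_mem {x a v : V} (h : v ∈ closedBranch G a x) :
    closedBranch G v x ⊆ closedBranch G a x := by
  intro z hz
  rw [mem_closedBranch_iff hG] at *
  have htriangle_a := hG.connected.dist_triangle (u := a) (v := v) (w := z)
  have htriangle_x := hG.connected.dist_triangle (u := x) (v := a) (w := z)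
  omega

lemma IsParent.mem_closedBranch {x a v : V} (h : IsParent G x v a) : v ∈ closedBranch G a x :=
  ((mem_branchNbrs_iff hG).2 h).2

lemma IsParent.closedBranch_subset {x a v : V} (h : IsParent G x v a) :
    closedBranch G v x ⊆ closedBranch G a x :=
  closedBranch_subset_of_mem hG (h.mem_closedBranch hG)

lemma IsParent.notMem_closedBranch {x a v : V} (h : IsParent G x v a) :
    a ∉ closedBranch G v x := by
  rw [mem_closedBranch_iff hG, ((isParent_iff hG).1 h).2]
  omega

lemma isParent_of_adj_of_notMem_closedBranch {x a v : V} (h : G.Adj v a)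
    (ha : a ∉ closedBranch G v x) : IsParent G x v a :=
  (isParent_or_isParent_of_adj hG x h).resolve_right fun hv => ha (hv.mem_closedBranch hG)

lemma exists_child {x a z : V} (hz : z ∈ closedBranch G a x) (hza : z ≠ a) :
    ∃ v, IsParent G x v a ∧ z ∈ closedBranch G v x := by
  obtain ⟨v, hv⟩ := exists_isParent hG (Ne.symm hza)
  obtain ⟨hadj, hdist⟩ := (isParent_iff hG).1 hv
  rw [mem_closedBranch_iff hG] at hz
  have htriangle := hG.connected.dist_triangle (u := x) (v := v) (w := z)
  rw [G.dist_comm (u := z), G.dist_comm (u := z)] at hdist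
  have hva : IsParent G x v a := by
    refine (isParent_or_isParent_of_adj hG x hadj).resolve_left fun hav => ?_
    have := ((isParent_iff hG).1 hav).2
    omega
  refine ⟨v, hva, ?_⟩
  have := ((isParent_iff hG).1 hva).2
  rw [mem_closedBranch_iff hG]
  omega

lemma child_unique {x a v w z : V} (hv : IsParent G x v a) (hw : IsParent G x w a)
    (hzv : z ∈ closedBranch G v x) (hzw : z ∈ closedBranch G w x) : v = w := by
  rw [hv.closedBranch_eq, mem_closedBranch_iff_isParent hG hv.adj.symm] at hzv
  rw [hw.closedBranch_eq, mem_closedBranch_iff_isParent hG hw.adj.symm] at hzw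
  exact hzv.unique hG hzw

lemma ne_root_of_mem_closedBranch {x a z : V} (hz : z ∈ closedBranch G a x) (hza : z ≠ a) :
    z ≠ x := by
  rintro rfl
  rw [mem_closedBranch_iff hG, SimpleGraph.dist_self, Nat.add_eq_zero_iff] at hz
  exact hza (hG.connected.dist_eq_zero_iff.1 hz.1)

lemma rooted_induction {P : V → Prop} {x : V} (root : P x)
    (step : ∀ y m, IsParent G x y m → P m → P y) (y : V) : P y := by
  induction hd : G.dist x y generalizing y with
  | zero => rwa [← hG.connected.dist_eq_zero_iff.1 hd]
  | succ d ih =>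
    obtain ⟨m, hm⟩ := exists_isParent hG (x := x) (y := y) (by
      rintro rfl
      simp at hd)
    have := ((isParent_iff hG).1 hm).2
    exact step y m hm (ih m (by omega))

lemma leaf_induction [Finite V] {P : V → Prop} (x : V)
    (step : ∀ y, (∀ v, IsParent G x v y → P v) → P y) (y : V) : P y := by
  induction hk : (closedBranch G y x).ncard using Nat.strong_induction_on generalizing y with
  | _ k ih =>
    refine step y fun v hv => ih _ ?_ v rfl
    rw [← hk]
    refine Set.ncard_lt_ncard ⟨hv.closedBranch_subset hG, fun hsub => ?_⟩
    exact hv.notMem_closedBranch hG (hsub (mem_closedBranch_self y x))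

end Branches

section Edges

lemma edgesIn_mono {S T : Set V} (h : S ⊆ T) : edgesIn G S ⊆ edgesIn G T :=
  fun _ he v hv => h (he v hv)

lemma branchEdges_eq_insert {y v : V} (h : G.Adj y v) :
    branchEdges G y v = insert ⟨s(y, v), h⟩ (edgesIn G (closedBranch G v y)) := by
  ext e
  simp [branchEdges, Subtype.ext_iff]

lemma mem_closedBranch_of_mem_branchEdges {y v z : V} {e : G.edgeSet} (he : e ∈ branchEdges G y v)
    (hz : z ∈ (e : Sym2 V)) (hzy : z ≠ y) : z ∈ closedBranch G v y := by
  rcases he with he | he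
  · rw [he, Sym2.mem_iff] at hz
    rw [hz.resolve_left hzy]
    exact mem_closedBranch_self v y
  · exact he z hz

lemma exists_mem_edge_ne (e : G.edgeSet) (y : V) : ∃ z ∈ (e : Sym2 V), z ≠ y := by
  obtain ⟨⟨a, b⟩, hab⟩ := e
  rcases eq_or_ne a y with rfl | ha
  · exact ⟨b, by simp, ((SimpleGraph.mem_edgeSet G).1 hab).ne'⟩
  · exact ⟨a, by simp, ha⟩

lemma mem_pathEdges_iff_mem_edges (hG : G.IsTree) {x y : V} {p : G.Walk x y} (hp : p.IsPath)
    (e : G.edgeSet) : e ∈ pathEdges G x y ↔ (e : Sym2 V) ∈ p.edges := by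
  refine ⟨fun ⟨q, hq, he⟩ => ?_, fun he => ⟨p, hp, he⟩⟩
  rwa [(hG.existsUnique_path x y).unique hp hq]

variable (hG : G.IsTree)
include hG

lemma disjoint_branchEdges {y v w : V} (hv : G.Adj y v) (hw : G.Adj y w) (hvw : v ≠ w) :
    Disjoint (branchEdges G y v) (branchEdges G y w) := by
  refine Set.disjoint_left.2 fun e hev hew => hvw ?_
  obtain ⟨z, hz, hzy⟩ := exists_mem_edge_ne e y
  exact child_unique hG (isParent_of_adj hG hv.symm) (isParent_of_adj hG hw.symm)
    (mem_closedBranch_of_mem_branchEdges hev hz hzy)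
    (mem_closedBranch_of_mem_branchEdges hew hz hzy)

lemma IsParent.branchEdges_subset {x a v : V} (h : IsParent G x v a) :
    branchEdges G a v ⊆ edgesIn G (closedBranch G a x) := by
  intro e he z hz
  rcases eq_or_ne z a with rfl | hza
  · exact mem_closedBranch_self z x
  · apply h.closedBranch_subset hG
    rw [h.closedBranch_eq]
    exact mem_closedBranch_of_mem_branchEdges he hz hza

lemma pathEdges_self (x : V) : pathEdges G x x = ∅ := by
  ext e
  simp [mem_pathEdges_iff_mem_edges hG SimpleGraph.Walk.IsPath.nil]

lemma IsParent.pathEdges_eq_insert {x y m : V} (h : IsParent G x y m) :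
    pathEdges G x y = insert ⟨s(y, m), h.adj⟩ (pathEdges G x m) := by
  obtain ⟨p, hp, -⟩ := hG.existsUnique_path x m
  ext e
  simp only [mem_pathEdges_iff_mem_edges hG (h.isPath_concat hG hp), Set.mem_insert_iff,
    mem_pathEdges_iff_mem_edges hG hp, Subtype.ext_iff, SimpleGraph.Walk.edges_concat,
    List.concat_eq_append, List.mem_append, List.mem_singleton, Sym2.eq_swap (a := m)]
  exact or_comm

lemma IsParent.pathEdges_subset {x y m : V} (h : IsParent G x y m) :
    pathEdges G x m ⊆ edgesIn G (openBranch G y x) := by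
  classical
  rintro e ⟨p, hp, he⟩ z hz
  have hzp : z ∈ p.support := p.mem_support_of_mem_edges he hz
  exact ⟨p.takeUntil z hzp, fun hy =>
    h.notMem_support hG hp (p.support_takeUntil_subset_support hzp hy)⟩

lemma IsParent.notMem_pathEdges {x y m : V} (h : IsParent G x y m) :
    (⟨s(y, m), h.adj⟩ : G.edgeSet) ∉ pathEdges G x m :=
  fun he => mem_closedBranch_self y x (h.pathEdges_subset hG he y (by simp))

lemma IsParent.pathEdges_union_edgesIn {x y m : V} (h : IsParent G x y m) :
    pathEdges G x y ∪ edgesIn G (openBranch G y x) = branchEdges G y m := by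
  rw [h.pathEdges_eq_insert hG, Set.insert_union,
    Set.union_eq_self_of_subset_left (h.pathEdges_subset hG), h.openBranch_eq hG,
    branchEdges_eq_insert h.adj]

end Edges

section CallTime

variable {ι : Type*} {ρ : ℝ} {N M : Finset ι} {f g : ι → ℝ}

/-- The optimal completion time of a sender that serves the receivers in `N` one after another,
where each connection takes time `ρ` and the receiver `v` needs the time `f v` after it. The largest
values are served first, so that `v` is completed by the time `k * ρ + f v`, where `k` is the number
of receivers whose value is at least `f v`. -/
noncomputable def callTime (ρ : ℝ) (N : Finset ι) (f : ι → ℝ) : ℝ :=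
  N.fold max 0 fun v => ((N.filter fun w => f v ≤ f w).card : ℝ) * ρ + f v

lemma callTime_le_iff {t : ℝ} : callTime ρ N f ≤ t ↔
    0 ≤ t ∧ ∀ v ∈ N, ((N.filter fun w => f v ≤ f w).card : ℝ) * ρ + f v ≤ t :=
  Finset.fold_max_le _

lemma callTime_nonneg : 0 ≤ callTime ρ N f := (callTime_le_iff.1 le_rfl).1

lemma exists_callTime_eq (hN : N.Nonempty) (hρ : 0 ≤ ρ) (hf : ∀ v ∈ N, 0 ≤ f v) :
    ∃ v ∈ N, callTime ρ N f = ((N.filter fun w => f v ≤ f w).card : ℝ) * ρ + f v := by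
  by_contra! hne
  have hlt : ∀ v ∈ N, ((N.filter fun w => f v ≤ f w).card : ℝ) * ρ + f v < callTime ρ N f :=
    fun v hv => lt_of_le_of_ne ((callTime_le_iff.1 le_rfl).2 v hv) (hne v hv).symm
  obtain ⟨v, hv⟩ := hN
  have hpos : 0 < callTime ρ N f :=
    (by have := hf v hv; positivity : (0 : ℝ) ≤ _).trans_lt (hlt v hv)
  exact lt_irrefl _ ((Finset.fold_max_lt _).2 ⟨hpos, hlt⟩ : callTime ρ N f < callTime ρ N f)

section Monotonicity

variable (hρ : 0 ≤ ρ)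
include hρ

lemma card_mul_add_le_callTime {A : Finset ι} {θ : ℝ} (hA : A ⊆ N) (hne : A.Nonempty)
    (hθ : ∀ w ∈ A, θ ≤ f w) : (A.card : ℝ) * ρ + θ ≤ callTime ρ N f := by
  obtain ⟨v, hv, hmin⟩ := A.exists_min_image f hne
  have hcard : A.card ≤ (N.filter fun w => f v ≤ f w).card :=
    Finset.card_le_card fun w hw => Finset.mem_filter.2 ⟨hA hw, hmin w hw⟩
  calc (A.card : ℝ) * ρ + θ ≤ ((N.filter fun w => f v ≤ f w).card : ℝ) * ρ + f v := by
        gcongr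
        exact hθ v hv
    _ ≤ callTime ρ N f := (callTime_le_iff.1 le_rfl).2 v (hA hv)

lemma add_le_callTime {v : ι} (hv : v ∈ N) : ρ + f v ≤ callTime ρ N f := by
  simpa using card_mul_add_le_callTime (f := f) hρ (Finset.singleton_subset_iff.2 hv)
    (Finset.singleton_nonempty v) (by simp)

lemma callTime_mono (hNM : N ⊆ M) (h : ∀ v ∈ N, f v ≤ g v) : callTime ρ N f ≤ callTime ρ M g := by
  refine callTime_le_iff.2 ⟨callTime_nonneg, fun v hv => ?_⟩
  refine card_mul_add_le_callTime hρ ((Finset.filter_subset _ _).trans hNM)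
    ⟨v, by simp [hv]⟩ fun w hw => ?_
  rw [Finset.mem_filter] at hw
  exact hw.2.trans (h w hw.1)

lemma callTime_congr (h : ∀ v ∈ N, f v = g v) : callTime ρ N f = callTime ρ N g :=
  le_antisymm (callTime_mono hρ subset_rfl fun v hv => (h v hv).le)
    (callTime_mono hρ subset_rfl fun v hv => (h v hv).ge)

lemma callTime_le_callTime_add {c : ℝ} (hc : 0 ≤ c) (h : ∀ v ∈ N, g v ≤ f v + c) :
    callTime ρ N g ≤ callTime ρ N f + c := by
  refine callTime_le_iff.2 ⟨add_nonneg callTime_nonneg hc, fun v hv => ?_⟩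
  have := card_mul_add_le_callTime (f := f) (θ := g v - c) hρ
    (Finset.filter_subset (fun w => g v ≤ g w) N) ⟨v, by simp [hv]⟩ fun w hw => by
      rw [Finset.mem_filter] at hw
      linarith [h w hw.1]
  linarith

lemma callTime_insert_le [DecidableEq ι] {m : ι} :
    callTime ρ (insert m N) f ≤ ρ + max (f m) (callTime ρ N f) := by
  have hmax := le_max_right (f m) (callTime ρ N f)
  refine callTime_le_iff.2 ⟨by linarith [callTime_nonneg (ρ := ρ) (N := N) (f := f)], ?_⟩
  intro v hv
  have hcard : (((insert m N).filter fun w => f v ≤ f w).card : ℝ) ≤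
      ((N.filter fun w => f v ≤ f w).card : ℝ) + 1 := by
    rw [Finset.filter_insert]
    split_ifs
    · exact_mod_cast Finset.card_insert_le _ _
    · simp
  have hmul := mul_le_mul_of_nonneg_right hcard hρ
  rcases (N.filter fun w => f v ≤ f w).eq_empty_or_nonempty with hempty | hne
  · obtain rfl : v = m := (Finset.mem_insert.1 hv).resolve_right fun h =>
      (Finset.filter_eq_empty_iff.1 hempty) h le_rfl
    rw [hempty, Finset.card_empty, Nat.cast_zero, zero_add, one_mul] at hmul
    linarith [le_max_left (f v) (callTime ρ N f)]
  · have := card_mul_add_le_callTime (f := f) hρ (Finset.filter_subset _ N) hne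
      fun w hw => (Finset.mem_filter.1 hw).2
    linarith

end Monotonicity

lemma card_mul_le_of_separated {t : ℝ} (hf : ∀ v ∈ N, 0 ≤ f v)
    (hsep : ∀ v ∈ N, ∀ w ∈ N, v ≠ w → f v + ρ ≤ f w ∨ f w + ρ ≤ f v)
    (hρ : 0 < ρ) (ht : 0 ≤ t) (hft : ∀ v ∈ N, f v + ρ ≤ t) : (N.card : ℝ) * ρ ≤ t := by
  classical
  induction N using Finset.induction_on_max_value f generalizing t with
  | empty => simpa
  | insert a N ha hmax ih =>
    have hcard : (N.card : ℝ) * ρ ≤ f a := by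
      refine ih (fun v hv => hf v (by simp [hv])) (fun v hv w hw => hsep v (by simp [hv]) w
        (by simp [hw])) (hf a (by simp)) fun v hv => ?_
      refine (hsep v (by simp [hv]) a (by simp) (by rintro rfl; exact ha hv)).resolve_right ?_
      linarith [hmax v hv]
    rw [Finset.card_insert_of_notMem ha, Nat.cast_add_one, add_one_mul]
    linarith [hft a (by simp)]

/-- The sequence `q 1, ..., q N.card` lists the elements of `N`, each once, in nonincreasing order
of their values under `f`. -/
structure IsDecreasingListing (N : Finset ι) (f : ι → ℝ) (q : ℕ → ι) : Prop where
  bijOn : Set.BijOn q (Set.Icc 1 N.card) N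
  antitoneOn : AntitoneOn (fun k => f (q k)) (Set.Icc 1 N.card)

lemma exists_isDecreasingListing [Nonempty ι] (N : Finset ι) (f : ι → ℝ) :
    ∃ q, IsDecreasingListing N f q := by
  classical
  induction N using Finset.induction_on_min_value f with
  | empty => exact ⟨fun _ => Classical.arbitrary ι, by simp, fun _ _ _ _ _ => le_rfl⟩
  | insert a N ha hmin ih =>
    obtain ⟨q, hbij, hanti⟩ := ih
    have hq : Set.EqOn (Function.update q (N.card + 1) a) q (Set.Icc 1 N.card) := fun k hk =>
      Function.update_of_ne (by have := hk.2; omega) _ _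
    have hcard : Set.Icc 1 (insert a N).card = insert (N.card + 1) (Set.Icc 1 N.card) := by
      ext k
      simp only [Finset.card_insert_of_notMem ha, Set.mem_Icc, Set.mem_insert_iff]
      omega
    refine ⟨Function.update q (N.card + 1) a, ?_, ?_⟩ <;> rw [hcard]
    · rw [Finset.coe_insert]
      simpa using (hbij.congr hq.symm).insert (a := N.card + 1) (by simpa using ha)
    · rintro k hk l (rfl | hl) hkl
      · rcases hk with rfl | hk
        · exact le_rfl
        · simpa [hq hk] using hmin _ (hbij.mapsTo hk)
      · have hk : k ∈ Set.Icc 1 N.card := hk.resolve_left (by have := hl.2; omega)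
        simpa [hq hk, hq hl] using hanti hk hl hkl

namespace IsDecreasingListing

variable {q : ℕ → ι} (hq : IsDecreasingListing N f q)
include hq

lemma le_apply_iff {k : ℕ} (hk : k ∈ Set.Icc 1 N.card) (θ : ℝ) :
    θ ≤ f (q k) ↔ k ≤ (N.filter fun v => θ ≤ f v).card := by
  classical
  constructor
  · intro hθ
    have hinj : Set.InjOn q (Finset.Icc 1 k) := hq.bijOn.injOn.mono fun l hl => by
      simp only [Finset.coe_Icc, Set.mem_Icc] at *
      omega
    rw [← Nat.add_sub_cancel k 1, ← Nat.card_Icc, ← Finset.card_image_of_injOn hinj]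
    refine Finset.card_le_card fun v hv => ?_
    obtain ⟨l, hl, rfl⟩ := Finset.mem_image.1 hv
    rw [Finset.mem_Icc] at hl
    have hl' : l ∈ Set.Icc 1 N.card := ⟨hl.1, hl.2.trans hk.2⟩
    exact Finset.mem_filter.2 ⟨hq.bijOn.mapsTo hl', hθ.trans (hq.antitoneOn hl' hk hl.2)⟩
  · contrapose!
    intro hθ
    have hsub : (N.filter fun v => θ ≤ f v) ⊆ (Finset.Icc 1 (k - 1)).image q := by
      intro v hv
      obtain ⟨hvN, hvθ⟩ := Finset.mem_filter.1 hv
      obtain ⟨l, hl, rfl⟩ := hq.bijOn.surjOn hvN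
      refine Finset.mem_image_of_mem q (Finset.mem_Icc.2 ⟨hl.1, ?_⟩)
      by_contra hkl
      exact (hvθ.trans (hq.antitoneOn hk hl (by omega))).not_gt hθ
    have hcard := (Finset.card_le_card hsub).trans Finset.card_image_le
    rw [Nat.card_Icc] at hcard
    have := hk.1
    omega

lemma mul_add_le_callTime (hρ : 0 ≤ ρ) {k : ℕ} (hk : k ∈ Set.Icc 1 N.card) :
    k * ρ + f (q k) ≤ callTime ρ N f :=
  calc k * ρ + f (q k) ≤ ((N.filter fun v => f (q k) ≤ f v).card : ℝ) * ρ + f (q k) := by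
        gcongr
        exact (hq.le_apply_iff hk _).1 le_rfl
    _ ≤ callTime ρ N f := (callTime_le_iff.1 le_rfl).2 _ (hq.bijOn.mapsTo hk)

lemma exists_callTime_eq (hN : N.Nonempty) (hρ : 0 ≤ ρ) (hf : ∀ v ∈ N, 0 ≤ f v) :
    ∃ k ∈ Set.Icc 1 N.card, callTime ρ N f = k * ρ + f (q k) := by
  obtain ⟨v, hv, hcall⟩ := Broadcast.exists_callTime_eq hN hρ hf
  have hk : (N.filter fun w => f v ≤ f w).card ∈ Set.Icc 1 N.card :=
    ⟨Finset.card_pos.2 ⟨v, by simp [hv]⟩, Finset.card_filter_le _ _⟩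
  refine ⟨_, hk, (hcall.trans_le ?_).antisymm (hq.mul_add_le_callTime hρ hk)⟩
  gcongr
  exact (hq.le_apply_iff hk _).2 le_rfl

end IsDecreasingListing

end CallTime

section Children

variable [Finite V]

/-- The finite set of children of `y` in the tree rooted at `x`. -/
noncomputable def children (G : SimpleGraph V) (x y : V) : Finset V :=
  (Set.toFinite (branchNbrs G x y)).toFinset

lemma coe_children (x y : V) : (children G x y : Set V) = branchNbrs G x y :=
  Set.Finite.coe_toFinset _

lemma card_children (x y : V) : (children G x y).card = branchDeg G x y :=
  (Set.ncard_eq_toFinset_card _ _).symm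

lemma mem_children_iff (hG : G.IsTree) {x y v : V} : v ∈ children G x y ↔ IsParent G x v y := by
  rw [← mem_branchNbrs_iff hG, ← coe_children, Finset.mem_coe]

end Children

section Recursion

variable {ρ : ℝ} {s : Weights G}

lemma wt_nonneg (hs : 0 ≤ s) (a b : V) : 0 ≤ wt s a b := by
  unfold wt
  split_ifs
  · exact hs _
  · exact le_rfl

lemma wt_of_adj {a b : V} (h : G.Adj a b) : wt s a b = s ⟨s(a, b), h⟩ := dif_pos h

lemma wt_comm (a b : V) : wt s a b = wt s b a := by
  by_cases h : G.Adj a b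
  · rw [wt_of_adj h, wt_of_adj h.symm]
    exact congrArg s (Subtype.ext Sym2.eq_swap)
  · rw [wt, wt, dif_neg h, dif_neg fun h' => h h'.symm]

/-- The times within which `u` can broadcast over `S`, so that `bTime ρ s u S` is the infimum. -/
def broadcastTimes (ρ : ℝ) (s : Weights G) (u : V) (S : Set V) : Set ℝ :=
  {t | ∃ (par : V → V) (call recv : V → ℝ),
    IsSchedule ρ s u S par call recv ∧ ∀ v ∈ S, recv v ≤ t}

lemma bTime_le_of_mem_broadcastTimes {u : V} {S : Set V} (hu : u ∈ S) {t : ℝ}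
    (ht : t ∈ broadcastTimes ρ s u S) : bTime ρ s u S ≤ t := by
  refine csInf_le ⟨0, ?_⟩ ht
  rintro t ⟨par, call, recv, h, hrecv⟩
  exact h.source ▸ hrecv u hu

lemma IsSchedule.recv_par_lt_recv {u v : V} {S : Set V} {par : V → V} {call recv : V → ℝ}
    (h : IsSchedule ρ s u S par call recv) (hρ : 0 < ρ) (hs : 0 ≤ s) (hv : v ∈ S) (hvu : v ≠ u) :
    recv (par v) < recv v := by
  linarith [h.informed v hv hvu, h.delivery v hv hvu, wt_nonneg hs (par v) v]

section Restriction

variable (hG : G.IsTree) {x a v : V} (hv : IsParent G x v a) {par : V → V} {call recv : V → ℝ}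
  (h : IsSchedule ρ s a (closedBranch G a x) par call recv)
include hG hv h

lemma IsSchedule.adj_of_mem_closedBranch_child {z : V} (hz : z ∈ closedBranch G v x) :
    G.Adj (par z) z :=
  h.adj z (hv.closedBranch_subset hG hz) fun hza => hv.notMem_closedBranch hG (hza ▸ hz)

lemma IsSchedule.par_mem_closedBranch_child {z : V} (hz : z ∈ closedBranch G v x) (hzv : z ≠ v) :
    par z ∈ closedBranch G v x := by
  by_contra hpar
  exact hzv (eq_of_adj_of_mem_of_notMem_closedBranch hz hpar
    (h.adj_of_mem_closedBranch_child hG hv hz).symm)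

-- The vertex of the branch that is informed first gets the message from outside the branch.
lemma IsSchedule.par_child_eq [Finite V] (hρ : 0 < ρ) (hs : 0 ≤ s) : par v = a := by
  have hvv := mem_closedBranch_self (G := G) v x
  have hadj := (h.adj_of_mem_closedBranch_child hG hv hvv).symm
  suffices hpar : par v ∉ closedBranch G v x from
    (isParent_of_adj_of_notMem_closedBranch hG hadj hpar).unique hG hv
  intro hpar
  obtain ⟨z, hz, hmin⟩ :=
    Set.exists_min_image (closedBranch G v x) recv (Set.toFinite _) ⟨v, hvv⟩
  have hpz : par z ∈ closedBranch G v x := by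
    rcases eq_or_ne z v with rfl | hzv
    · exact hpar
    · exact h.par_mem_closedBranch_child hG hv hz hzv
  refine (h.recv_par_lt_recv hρ hs (hv.closedBranch_subset hG hz) ?_).not_ge (hmin _ hpz)
  rintro rfl
  exact hv.notMem_closedBranch hG hz

lemma IsSchedule.restrict_child : IsSchedule ρ s v (closedBranch G v x) par
    (fun z => call z - recv v) (fun z => recv z - recv v) := by
  have hsub := hv.closedBranch_subset hG
  have hne : ∀ z ∈ closedBranch G v x, z ≠ a := by
    rintro z hz rfl
    exact hv.notMem_closedBranch hG hz
  refine ⟨sub_self _, fun z hz hzv => h.par_mem_closedBranch_child hG hv hz hzv,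
    fun z hz _ => h.adj_of_mem_closedBranch_child hG hv hz, fun z hz _ => ?_, fun z hz _ => ?_,
    fun z hz w hw _ _ hzw hpar => ?_⟩
  · exact sub_le_sub_right (h.informed z (hsub hz) (hne z hz)) _
  · rw [h.delivery z (hsub hz) (hne z hz)]
    ring
  · refine (h.sequential z (hsub hz) w (hsub hw) (hne z hz) (hne w hw) hzw hpar).imp ?_ ?_ <;>
      intro hle <;> linarith

end Restriction

lemma callTime_le_of_mem_broadcastTimes [Finite V] (hG : G.IsTree) (hρ : 0 < ρ) (hs : 0 ≤ s)
    {x a : V} {t : ℝ} (ht : t ∈ broadcastTimes ρ s a (closedBranch G a x)) :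
    callTime ρ (children G x a) (branchValue ρ s a) ≤ t := by
  obtain ⟨par, call, recv, h, hrecv⟩ := ht
  have hmem : ∀ v ∈ children G x a, v ∈ closedBranch G a x ∧ v ≠ a ∧ par v = a := fun v hv => by
    rw [mem_children_iff hG] at hv
    exact ⟨hv.mem_closedBranch hG, hv.adj.ne, h.par_child_eq hG hv hρ hs⟩
  have hvalue : ∀ v ∈ children G x a, branchValue ρ s a v ≤ t - ρ - call v := by
    intro v hv
    obtain ⟨hva, hne, hpar⟩ := hmem v hv
    rw [mem_children_iff hG] at hv
    have hb : bTime ρ s v (closedBranch G v x) ≤ t - recv v :=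
      bTime_le_of_mem_broadcastTimes (mem_closedBranch_self v x)
        ⟨par, _, _, h.restrict_child hG hv,
          fun z hz => sub_le_sub_right (hrecv z (hv.closedBranch_subset hG hz)) _⟩
    have hdelivery := h.delivery v hva hne
    rw [hpar] at hdelivery
    rw [branchValue, ← hv.closedBranch_eq]
    linarith
  have hcall : ∀ v ∈ children G x a, 0 ≤ call v := fun v hv => by
    obtain ⟨hva, hne, hpar⟩ := hmem v hv
    simpa [hpar, h.source] using h.informed v hva hne
  refine (callTime_mono hρ.le subset_rfl hvalue).trans (callTime_le_iff.2 ⟨?_, fun v hv => ?_⟩)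
  · exact h.source ▸ hrecv a (mem_closedBranch_self a x)
  · have hcard := card_mul_le_of_separated (t := call v + ρ)
      (N := (children G x a).filter fun w => t - ρ - call v ≤ t - ρ - call w) (f := call)
      (fun w hw => hcall w (Finset.mem_filter.1 hw).1)
      (fun w hw z hz hwz => by
        obtain ⟨hwa, hwne, hwpar⟩ := hmem w (Finset.mem_filter.1 hw).1
        obtain ⟨hza, hzne, hzpar⟩ := hmem z (Finset.mem_filter.1 hz).1
        exact h.sequential w hwa z hza hwne hzne hwz (hwpar.trans hzpar.symm))
      hρ (by linarith [hcall v hv]) (fun w hw => by linarith [(Finset.mem_filter.1 hw).2])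
    linarith

/-- A rule for the tree rooted at `x` by which every vertex `z ≠ x` is the receiver number `rank z`
of its parent `par z`, and distinct receivers of the same vertex have distinct numbers. -/
structure IsServiceOrder (G : SimpleGraph V) (x : V) (par : V → V) (rank : V → ℕ) : Prop where
  isParent : ∀ z, z ≠ x → IsParent G x z (par z)
  one_le_rank : ∀ z, z ≠ x → 1 ≤ rank z
  eq_of_rank_eq : ∀ z w, z ≠ x → w ≠ x → par z = par w → rank z = rank w → z = w

lemma exists_isServiceOrder [Finite V] (hG : G.IsTree) (hρ : 0 ≤ ρ) (x : V) (f : V → V → ℝ) :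
    ∃ par rank, IsServiceOrder G x par rank ∧ ∀ z, z ≠ x →
      rank z * ρ + f (par z) z ≤ callTime ρ (children G x (par z)) (f (par z)) := by
  have := Nonempty.intro x
  choose q hq using fun m => exists_isDecreasingListing (children G x m) (f m)
  choose! par hpar using fun z (hz : z ≠ x) => exists_isParent hG hz
  choose! rank hrank hqrank using fun z (hz : z ≠ x) =>
    (hq (par z)).bijOn.surjOn ((mem_children_iff hG).2 (hpar z hz))
  refine ⟨par, rank, ⟨hpar, fun z hz => (hrank z hz).1, fun z w hz hw hzw h => ?_⟩, fun z hz => ?_⟩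
  · rw [← hqrank z hz, ← hqrank w hw, hzw, h]
  · simpa [hqrank z hz] using (hq (par z)).mul_add_le_callTime hρ (hrank z hz)

lemma exists_potential (hG : G.IsTree) (x : V) (w : V → V → ℝ) :
    ∃ φ : V → ℝ, ∀ z m, IsParent G x z m → φ z = φ m + w m z := by
  choose p hp using fun z => (hG.existsUnique_path x z).exists
  refine ⟨fun z => ((p z).darts.map fun d => w d.fst d.snd).sum, fun z m h => ?_⟩
  simp [(hG.existsUnique_path x z).unique (hp z) (h.isPath_concat hG (hp m))]

lemma IsServiceOrder.isSchedule (hG : G.IsTree) (hρ : 0 ≤ ρ) {x : V} {par : V → V} {rank : V → ℕ}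
    (h : IsServiceOrder G x par rank) {φ : V → ℝ}
    (hφ : ∀ z, z ≠ x → φ z = φ (par z) + (rank z * ρ + wt s (par z) z)) (a : V) :
    IsSchedule ρ s a (closedBranch G a x) par (fun z => φ (par z) + (rank z - 1) * ρ - φ a)
      (fun z => φ z - φ a) := by
  have hroot : ∀ z ∈ closedBranch G a x, z ≠ a → z ≠ x :=
    fun z hz hza => ne_root_of_mem_closedBranch hG hz hza
  refine ⟨sub_self _, fun z hz hza => ?_, fun z hz hza => ?_, fun z hz hza => ?_,
    fun z hz hza => ?_, fun z hz w hw hza hwa hzw hpar => ?_⟩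
  · by_contra hnot
    exact hza (eq_of_adj_of_mem_of_notMem_closedBranch hz hnot (h.isParent z (hroot z hz hza)).adj)
  · exact (h.isParent z (hroot z hz hza)).adj.symm
  · have hrank : (1 : ℝ) ≤ rank z := by exact_mod_cast h.one_le_rank z (hroot z hz hza)
    have := mul_nonneg (sub_nonneg.2 hrank) hρ
    linarith
  · rw [hφ z (hroot z hz hza)]
    ring
  · have hrank : rank z ≠ rank w := fun hrank =>
      hzw (h.eq_of_rank_eq z w (hroot z hz hza) (hroot w hw hwa) hpar hrank)
    rw [hpar]
    refine hrank.lt_or_gt.imp (fun hlt => ?_) fun hlt => ?_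
    all_goals
      have := mul_le_mul_of_nonneg_right (Nat.cast_le (α := ℝ).2 (Nat.succ_le_of_lt hlt)) hρ
      push_cast at this
      linarith

/-- A schedule restricts to the branch of each child, which gives the lower bound. It is attained
when every vertex serves its children in nonincreasing order of their branch values. -/
lemma bTime_closedBranch [Finite V] (hG : G.IsTree) (hρ : 0 < ρ) (hs : 0 ≤ s) (x a : V) :
    bTime ρ s a (closedBranch G a x) = callTime ρ (children G x a) (branchValue ρ s a) := by
  obtain ⟨par, rank, horder, hrank⟩ := exists_isServiceOrder hG hρ.le x (branchValue ρ s)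
  obtain ⟨φ, hφ⟩ := exists_potential hG x fun m z => rank z * ρ + wt s m z
  have hschedule := horder.isSchedule hG hρ.le fun z hz => hφ z _ (horder.isParent z hz)
  suffices h : bTime ρ s a (closedBranch G a x) = callTime ρ (children G x a) (branchValue ρ s a) ∧
      ∀ z ∈ closedBranch G a x, φ z - φ a ≤ bTime ρ s a (closedBranch G a x) from h.1
  induction a using leaf_induction hG x with
  | step a ih =>
    have hle : ∀ z ∈ closedBranch G a x,
        φ z - φ a ≤ callTime ρ (children G x a) (branchValue ρ s a) := by
      intro z hz
      rcases eq_or_ne z a with rfl | hza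
      · rw [sub_self]
        exact callTime_nonneg
      obtain ⟨v, hv, hzv⟩ := exists_child hG hz hza
      have hz_le := (ih v hv).2 z hzv
      have hv_le := hrank v (hv.ne_root hG)
      rw [(horder.isParent v (hv.ne_root hG)).unique hG hv, branchValue,
        ← hv.closedBranch_eq] at hv_le
      linarith [hφ v a hv]
    have hmem : callTime ρ (children G x a) (branchValue ρ s a) ∈
        broadcastTimes ρ s a (closedBranch G a x) := ⟨par, _, _, hschedule a, hle⟩
    have heq := (bTime_le_of_mem_broadcastTimes (mem_closedBranch_self a x) hmem).antisymm
      (le_csInf ⟨_, hmem⟩ fun t ht => callTime_le_of_mem_broadcastTimes hG hρ hs ht)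
    exact ⟨heq, heq ▸ hle⟩

lemma bTime_univ [Finite V] (hG : G.IsTree) (hρ : 0 < ρ) (hs : 0 ≤ s) (a : V) :
    bTime ρ s a Set.univ = callTime ρ (children G a a) (branchValue ρ s a) := by
  rw [← closedBranch_self (G := G) a, bTime_closedBranch hG hρ hs]

end Recursion

section Perturbation

variable {ρ : ℝ} {s s' : Weights G}

lemma bTime_le_branchValue (hs : 0 ≤ s) (a v : V) :
    bTime ρ s v (closedBranch G v a) ≤ branchValue ρ s a v :=
  le_add_of_nonneg_left (wt_nonneg hs a v)

lemma finsum_mem_mono_set {ι : Type*} {S T : Set ι} (hT : T.Finite) {f : ι → ℝ} (hf : 0 ≤ f)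
    (hST : S ⊆ T) : ∑ᶠ i ∈ S, f i ≤ ∑ᶠ i ∈ T, f i := by
  rw [← finsum_mem_add_sdiff hST hT]
  exact le_add_of_nonneg_right (finsum_nonneg fun i => finsum_nonneg fun _ => hf i)

variable [Finite V] (hG : G.IsTree) (hρ : 0 < ρ)
include hG hρ

lemma bTime_nonneg (hs : 0 ≤ s) (a x : V) : 0 ≤ bTime ρ s a (closedBranch G a x) := by
  rw [bTime_closedBranch hG hρ hs]
  exact callTime_nonneg

lemma branchValue_nonneg (hs : 0 ≤ s) (a v : V) : 0 ≤ branchValue ρ s a v :=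
  (bTime_nonneg hG hρ hs v a).trans (bTime_le_branchValue hs a v)

lemma bTime_le_bTime_add_finsum (hs : 0 ≤ s) (hs' : 0 ≤ s') {δ : Weights G} (hδ : 0 ≤ δ) {a x : V}
    (h : ∀ e ∈ edgesIn G (closedBranch G a x), s e ≤ s' e + δ e) :
    bTime ρ s a (closedBranch G a x) ≤
      bTime ρ s' a (closedBranch G a x) + ∑ᶠ e ∈ edgesIn G (closedBranch G a x), δ e := by
  induction a using leaf_induction hG x with
  | step a ih =>
    rw [bTime_closedBranch hG hρ hs, bTime_closedBranch hG hρ hs']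
    refine callTime_le_callTime_add hρ.le
      (finsum_nonneg fun e => finsum_nonneg fun _ => hδ e) fun v hv => ?_
    rw [mem_children_iff hG] at hv
    have hbranch := ih v hv fun e he => h e (edgesIn_mono (hv.closedBranch_subset hG) he)
    have hedge : (⟨s(a, v), hv.adj.symm⟩ : G.edgeSet) ∉ edgesIn G (closedBranch G v x) :=
      fun he => hv.notMem_closedBranch hG (he a (by simp))
    have hsum := finsum_mem_mono_set (Set.toFinite _) hδ (hv.branchEdges_subset hG)
    rw [branchEdges_eq_insert hv.adj.symm, ← hv.closedBranch_eq,
      finsum_mem_insert _ hedge (Set.toFinite _)] at hsum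
    rw [branchValue, branchValue, wt_of_adj hv.adj.symm, wt_of_adj hv.adj.symm,
      ← hv.closedBranch_eq]
    linarith [h ⟨s(a, v), hv.adj.symm⟩ (hv.branchEdges_subset hG (Or.inl rfl))]

lemma bTime_mono (hs : 0 ≤ s) (hs' : 0 ≤ s') {a x : V}
    (h : ∀ e ∈ edgesIn G (closedBranch G a x), s e ≤ s' e) :
    bTime ρ s a (closedBranch G a x) ≤ bTime ρ s' a (closedBranch G a x) := by
  simpa using bTime_le_bTime_add_finsum hG hρ hs hs' (δ := 0) le_rfl (by simpa using h)

lemma branchValue_mono (hs : 0 ≤ s) (hs' : 0 ≤ s') {a v : V} (hv : G.Adj a v)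
    (h : ∀ e ∈ branchEdges G a v, s e ≤ s' e) : branchValue ρ s a v ≤ branchValue ρ s' a v := by
  rw [branchValue, branchValue, wt_of_adj hv, wt_of_adj hv]
  exact add_le_add (h _ (Or.inl rfl)) (bTime_mono hG hρ hs hs' fun e he => h e (Or.inr he))

lemma branchValue_congr (hs : 0 ≤ s) (hs' : 0 ≤ s') {a v : V} (hv : G.Adj a v)
    (h : (branchEdges G a v).EqOn s s') : branchValue ρ s a v = branchValue ρ s' a v :=
  le_antisymm (branchValue_mono hG hρ hs hs' hv fun _ he => (h he).le)
    (branchValue_mono hG hρ hs' hs hv fun _ he => (h he).ge)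

lemma continuousOn_bTime (a x : V) :
    ContinuousOn (fun s : Weights G => bTime ρ s a (closedBranch G a x)) (Set.Ici 0) := by
  have := Fintype.ofFinite G.edgeSet
  refine (LipschitzOnWith.of_le_add_mul (Fintype.card G.edgeSet) fun s hs s' hs' => ?_).continuousOn
  have hdist : ∀ e, s e ≤ s' e + dist s s' := fun e => by
    have := dist_le_pi_dist s s' e
    rw [Real.dist_eq] at this
    linarith [le_abs_self (s e - s' e)]
  calc bTime ρ s a (closedBranch G a x)
      ≤ bTime ρ s' a (closedBranch G a x) + ∑ᶠ e ∈ edgesIn G (closedBranch G a x), dist s s' :=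
        bTime_le_bTime_add_finsum hG hρ hs hs' (fun _ => dist_nonneg) fun e _ => hdist e
    _ ≤ bTime ρ s' a (closedBranch G a x) + ∑ᶠ e ∈ Set.univ, dist s s' := by
        gcongr
        exact finsum_mem_mono_set (Set.toFinite _) (fun _ => dist_nonneg) (Set.subset_univ _)
    _ = _ := by simp [finsum_eq_sum_of_fintype]

end Perturbation

section WorstCase

variable {ρ : ℝ} {s s' lo hi : Weights G} {x y : V}

lemma nonneg_of_mem_scenarios (hlo : 0 ≤ lo) (hs : s ∈ scenarios lo hi) : 0 ≤ s :=
  fun e => (hlo e).trans (hs e).1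

lemma scenarios_eq_Icc (lo hi : Weights G) : scenarios lo hi = Set.Icc lo hi :=
  Set.ext fun _ => forall_and

/-- The values `r^s_{x,y}` over all scenarios `s` and all vertices `y`. Their maximum is the maximum
regret of `x`. -/
def regrets (ρ : ℝ) (lo hi : Weights G) (x : V) : Set ℝ :=
  {r | ∃ s ∈ scenarios lo hi, ∃ y, r = regret ρ s x y}

lemma isWorstCase_of_le {R : ℝ} (hR : IsGreatest (regrets ρ lo hi x) R)
    (hs : s ∈ scenarios lo hi) (h : R ≤ regret ρ s x y) : IsWorstCase ρ lo hi x s :=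
  ⟨hs, y, ⟨s, hs, y, rfl⟩, fun _ hr => (hR.2 hr).trans h⟩

lemma IsWorstCase.isGreatest (hs : IsWorstCase ρ lo hi x s) (hy : IsCenter ρ s y) :
    IsGreatest (regrets ρ lo hi x) (regret ρ s x y) := by
  obtain ⟨hmem, z, hz⟩ := hs
  exact ⟨⟨s, hmem, y, rfl⟩, fun r hr => (hz.2 hr).trans (sub_le_sub_left (hy z) _)⟩

lemma isWorstCase_of_isCenter (hs : IsWorstCase ρ lo hi x s) (hx : IsCenter ρ s x)
    (hs' : s' ∈ scenarios lo hi) : IsWorstCase ρ lo hi x s' :=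
  isWorstCase_of_le (y := x) (hs.isGreatest hx) hs' (by simp only [regret, sub_self, le_refl])

lemma exists_isWorstCase [Finite V] (hG : G.IsTree) (hρ : 0 < ρ) (hlo : 0 ≤ lo) (hlohi : lo ≤ hi)
    (x : V) : ∃ s, IsWorstCase ρ lo hi x s := by
  have hcont (y : V) : ContinuousOn (fun s => regret ρ s x y) (scenarios lo hi) := by
    have hbTime (a : V) := (continuousOn_bTime hG hρ a a).mono
      fun s hs => nonneg_of_mem_scenarios (hi := hi) hlo hs
    simp only [closedBranch_self] at hbTime
    exact (hbTime x).sub (hbTime y)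
  have hcompact : IsCompact (scenarios lo hi) := scenarios_eq_Icc lo hi ▸ isCompact_Icc
  have hne : (scenarios lo hi).Nonempty := ⟨lo, fun e => ⟨le_rfl, hlohi e⟩⟩
  choose σ hσ hmax using fun y => hcompact.exists_isMaxOn hne (hcont y)
  have : Nonempty V := ⟨x⟩
  obtain ⟨y, hy⟩ := Finite.exists_max fun y => regret ρ (σ y) x y
  refine ⟨σ y, hσ y, y, ⟨σ y, hσ y, y, rfl⟩, ?_⟩
  rintro r ⟨s, hs, z, rfl⟩
  exact (hmax z hs).trans (hy z)

end WorstCase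

section Paths

variable {ρ : ℝ} {s : Weights G}

/-- The cost `d_{x,y} ρ + w̃^s_{x,y}` of the path from `x` to `y`. -/
noncomputable def pathCost (ρ : ℝ) (s : Weights G) (x y : V) : ℝ :=
  (pathEdges G x y).ncard * ρ + pathWeight s x y

lemma criterion_eq (x y : V) : criterion ρ s x y =
    pathCost ρ s x y + bTime ρ s y (closedBranch G y x) - bTime ρ s y Set.univ := rfl

lemma pathCost_self (hG : G.IsTree) (x : V) : pathCost ρ s x x = 0 := by
  simp [pathCost, pathWeight, pathEdges_self hG]

lemma pathCost_nonneg (hρ : 0 ≤ ρ) (hs : 0 ≤ s) (x y : V) : 0 ≤ pathCost ρ s x y :=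
  add_nonneg (by positivity) (finsum_nonneg fun e => finsum_nonneg fun _ => hs e)

variable [Finite V]

lemma IsParent.pathCost_eq (hG : G.IsTree) {x y m : V} (h : IsParent G x y m) :
    pathCost ρ s x y = pathCost ρ s x m + ρ + wt s m y := by
  have hnotMem := h.notMem_pathEdges hG
  rw [pathCost, pathWeight, h.pathEdges_eq_insert hG,
    Set.ncard_insert_of_notMem hnotMem (Set.toFinite _),
    finsum_mem_insert _ hnotMem (Set.toFinite _), wt_comm, wt_of_adj h.adj, pathCost, pathWeight]
  push_cast
  ring

lemma pathCost_add_bTime_le (hG : G.IsTree) (hρ : 0 < ρ) (hs : 0 ≤ s) (x y : V) :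
    pathCost ρ s x y + bTime ρ s y (closedBranch G y x) ≤ bTime ρ s x Set.univ := by
  induction y using rooted_induction hG (x := x) with
  | root => rw [pathCost_self hG, closedBranch_self, zero_add]
  | step y m h ih =>
    have hcall := add_le_callTime (f := branchValue ρ s m) hρ.le ((mem_children_iff hG).2 h)
    rw [← bTime_closedBranch hG hρ hs, branchValue, ← h.closedBranch_eq] at hcall
    rw [h.pathCost_eq hG]
    linarith

lemma criterion_le_regret (hG : G.IsTree) (hρ : 0 < ρ) (hs : 0 ≤ s) (x y : V) :
    criterion ρ s x y ≤ regret ρ s x y :=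
  sub_le_sub_right (pathCost_add_bTime_le hG hρ hs x y) _

end Paths

section Centers

variable {ρ : ℝ} {s : Weights G} [Finite V] (hG : G.IsTree)
include hG

lemma mem_children_iff_of_adj {m y w : V} (h : G.Adj m y) :
    w ∈ children G y m ↔ G.Adj m w ∧ w ≠ y := by
  rw [mem_children_iff hG]
  refine ⟨fun hw => ⟨hw.adj.symm, hw.ne_root hG⟩, fun ⟨hadj, hne⟩ => ?_⟩
  exact (isParent_or_isParent_of_adj hG y hadj.symm).resolve_right fun hw =>
    hne (hw.unique hG (isParent_of_adj hG h))

lemma insert_children_eq [DecidableEq V] {a m : V} (hm : G.Adj a m) :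
    insert m (children G m a) = children G a a := by
  ext v
  rw [Finset.mem_insert, mem_children_iff_of_adj hG hm, mem_children_iff hG]
  constructor
  · rintro (rfl | hv)
    · exact isParent_of_adj hG hm.symm
    · exact isParent_of_adj hG hv.1.symm
  · exact fun hv => or_iff_not_imp_left.2 fun hne => ⟨hv.adj.symm, hne⟩

variable (hρ : 0 < ρ) (hs : 0 ≤ s)
include hρ hs

lemma bTime_univ_eq_callTime_insert [DecidableEq V] {a m : V} (hm : G.Adj a m) :
    bTime ρ s a Set.univ = callTime ρ (insert m (children G m a)) (branchValue ρ s a) := by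
  rw [insert_children_eq hG hm, bTime_univ hG hρ hs]

lemma bTime_univ_le {a m : V} (hm : G.Adj a m) : bTime ρ s a Set.univ ≤
    ρ + max (branchValue ρ s a m) (bTime ρ s a (closedBranch G a m)) := by
  classical
  rw [bTime_univ_eq_callTime_insert hG hρ hs hm, bTime_closedBranch hG hρ hs]
  exact callTime_insert_le hρ.le

/-- If the side of the child `y` dominates the edge to its parent `m`, then `m` serves `y` first and
is done with everything else before `y` is. -/
lemma IsParent.bTime_eq {x y m : V} (h : IsParent G x y m)
    (hle : bTime ρ s m (closedBranch G m y) ≤ bTime ρ s y (closedBranch G y m)) :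
    bTime ρ s m (closedBranch G m x) = ρ + branchValue ρ s m y := by
  classical
  have hmem := (mem_children_iff hG).2 h
  have herase : callTime ρ ((children G x m).erase y) (branchValue ρ s m) ≤
      bTime ρ s m (closedBranch G m y) := by
    rw [bTime_closedBranch hG hρ hs]
    refine callTime_mono hρ.le (fun w hw => ?_) fun _ _ => le_rfl
    rw [Finset.mem_erase, mem_children_iff hG] at hw
    exact (mem_children_iff_of_adj hG h.adj.symm).2 ⟨hw.2.adj.symm, hw.1⟩
  rw [bTime_closedBranch hG hρ hs]
  refine le_antisymm ?_ (add_le_callTime hρ.le hmem)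
  rw [← Finset.insert_erase hmem]
  exact (callTime_insert_le hρ.le).trans_eq
    (by rw [max_eq_left (herase.trans (hle.trans (bTime_le_branchValue hs m y)))])

lemma IsParent.bTime_le_of_le {x y m t : V} (hy : IsParent G x y m) (hm : IsParent G x m t)
    (hle : bTime ρ s m (closedBranch G m y) ≤ bTime ρ s y (closedBranch G y m)) :
    bTime ρ s t (closedBranch G t m) ≤ bTime ρ s m (closedBranch G m t) := by
  have hty : t ≠ y := by
    rintro rfl
    exact hy.notMem_closedBranch hG (hm.mem_closedBranch hG)
  calc bTime ρ s t (closedBranch G t m)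
      ≤ branchValue ρ s m t := bTime_le_branchValue hs m t
    _ ≤ ρ + branchValue ρ s m t := le_add_of_nonneg_left hρ.le
    _ ≤ bTime ρ s m (closedBranch G m y) := by
      rw [bTime_closedBranch hG hρ hs]
      exact add_le_callTime hρ.le ((mem_children_iff_of_adj hG hy.adj.symm).2 ⟨hm.adj, hty⟩)
    _ ≤ bTime ρ s y (closedBranch G y m) := hle
    _ ≤ branchValue ρ s m y := bTime_le_branchValue hs m y
    _ ≤ ρ + branchValue ρ s m y := le_add_of_nonneg_left hρ.le
    _ = bTime ρ s m (closedBranch G m t) := by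
      rw [← hm.closedBranch_eq, hy.bTime_eq hG hρ hs hle]

lemma IsParent.bTime_univ_eq {x y m : V} (h : IsParent G x y m)
    (hle : bTime ρ s m (closedBranch G m y) ≤ bTime ρ s y (closedBranch G y m)) :
    bTime ρ s x Set.univ = pathCost ρ s x m + ρ + branchValue ρ s m y := by
  suffices hm : bTime ρ s x Set.univ = pathCost ρ s x m + bTime ρ s m (closedBranch G m x) by
    rw [hm, h.bTime_eq hG hρ hs hle, add_assoc]
  induction m using rooted_induction hG (x := x) generalizing y with
  | root => rw [pathCost_self hG, closedBranch_self, zero_add]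
  | step m t hm ih =>
    have hle_parent := h.bTime_le_of_le hG hρ hs hm hle
    rw [ih hm hle_parent, hm.bTime_eq hG hρ hs hle_parent, hm.pathCost_eq hG, branchValue,
      hm.closedBranch_eq]
    ring

lemma criterion_eq_regret {x y : V} (hxy : y ≠ x) (hy : IsPrimeCenter ρ s y) :
    criterion ρ s x y = regret ρ s x y := by
  obtain ⟨m, hm⟩ := exists_isParent hG hxy
  rw [criterion_eq, regret, hm.bTime_univ_eq hG hρ hs (hy.2 m hm.adj), hm.pathCost_eq hG,
    branchValue, hm.closedBranch_eq]
  ring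

lemma IsParent.pathCost_add_bTime_univ_le {z k m : V} (hm : IsParent G z k m)
    (hle : bTime ρ s m (closedBranch G m k) ≤ bTime ρ s k (closedBranch G k m)) :
    pathCost ρ s z m + bTime ρ s k Set.univ ≤ bTime ρ s z Set.univ := by
  rw [hm.bTime_univ_eq hG hρ hs hle, add_assoc]
  gcongr
  refine (bTime_univ_le hG hρ hs hm.adj).trans (add_le_add_right (max_le ?_ ?_) ρ)
  · rw [branchValue, branchValue, wt_comm k m]
    exact add_le_add_right hle _
  · exact bTime_le_branchValue hs m k

lemma isPrimeCenter_of_forall_le {k : V} (hk : ∀ u, G.Adj k u →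
    bTime ρ s u (closedBranch G u k) ≤ bTime ρ s k (closedBranch G k u)) :
    IsPrimeCenter ρ s k := by
  refine ⟨fun z => ?_, hk⟩
  rcases eq_or_ne k z with rfl | hkz
  · exact le_rfl
  · obtain ⟨m, hm⟩ := exists_isParent hG hkz
    linarith [hm.pathCost_add_bTime_univ_le hG hρ hs (hk m hm.adj),
      pathCost_nonneg hρ.le hs z m]

lemma exists_isPrimeCenter : ∃ k, IsPrimeCenter ρ s k := by
  obtain ⟨x⟩ := hG.connected.nonempty
  by_contra! hnone
  have hlighter : ∀ k, ∃ u, G.Adj k u ∧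
      bTime ρ s k (closedBranch G k u) < bTime ρ s u (closedBranch G u k) := by
    intro k
    by_contra! hk
    exact hnone k (isPrimeCenter_of_forall_le hG hρ hs hk)
  have hparent : ∀ y, ∃ m, IsParent G x y m ∧
      bTime ρ s y (closedBranch G y m) < bTime ρ s m (closedBranch G m y) := by
    refine leaf_induction hG x fun y ih => ?_
    obtain ⟨u, hu, hlt⟩ := hlighter y
    refine ⟨u, (isParent_or_isParent_of_adj hG x hu).resolve_right fun hchild => ?_, hlt⟩
    obtain ⟨m, hm, hlt'⟩ := ih u hchild
    rw [hm.unique hG hchild] at hlt'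
    exact lt_asymm hlt hlt'
  obtain ⟨m, hm, -⟩ := hparent x
  exact hm.ne_root hG rfl

lemma IsCenter.eq_or_adj {y k : V} (hy : IsCenter ρ s y) (hk : IsPrimeCenter ρ s k) :
    k = y ∨ G.Adj k y := by
  by_contra! hne
  obtain ⟨m, hm⟩ := exists_isParent hG hne.1
  have hmy : m ≠ y := by
    rintro rfl
    exact hne.2 hm.adj
  obtain ⟨t, ht⟩ := exists_isParent hG hmy
  have hk_le := hm.pathCost_add_bTime_univ_le hG hρ hs (hk.2 m hm.adj)
  rw [ht.pathCost_eq hG] at hk_le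
  linarith [hy k, pathCost_nonneg hρ.le hs y t, wt_nonneg hs t m]

end Centers

section Shift

variable {ι : Type*} {n j : ℕ} {u q : ℕ → ι} {N : Set ι}

/-- The position in `Q_j` of the entry at position `k` of `Q_{j+1}`, when the entry that is moved to
position `j + 1` has position `l` in `Q_j`. -/
def shiftIndex (j l k : ℕ) : ℕ :=
  if k ≤ j then k else if k = j + 1 then l else if k ≤ l then k - 1 else k

lemma bijOn_shiftIndex {l : ℕ} (hjl : j < l) (hln : l ≤ n) :
    Set.BijOn (shiftIndex j l) (Set.Icc 1 n) (Set.Icc 1 n) := by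
  refine ((Set.finite_Icc 1 n).injOn_iff_bijOn_of_mapsTo fun k hk => ?_).1 fun k hk i hi heq => ?_
  · simp only [shiftIndex, Set.mem_Icc] at *
    split_ifs <;> omega
  · simp only [shiftIndex, Set.mem_Icc] at *
    split_ifs at heq <;> omega

lemma shiftSeq_eq_of_mem_Icc {k : ℕ} (hk : k ∈ Set.Icc 1 j) : shiftSeq n u q j k = u k := by
  induction j with
  | zero => exact absurd hk (by simp)
  | succ j ih =>
    rcases hk.2.eq_or_lt with rfl | hkj
    · simp [shiftSeq]
    · exact (if_pos (Nat.lt_succ_iff.1 hkj)).trans (ih ⟨hk.1, Nat.lt_succ_iff.1 hkj⟩)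

lemma lt_iff_lt_of_shiftSeq_eq (hu : Set.InjOn u (Set.Icc 1 n))
    (hq : Set.InjOn (shiftSeq n u q j) (Set.Icc 1 n)) {k m : ℕ} (hk : k ∈ Set.Icc 1 n)
    (hm : m ∈ Set.Icc 1 n) (h : shiftSeq n u q j k = u m) : j < k ↔ j < m := by
  rw [← not_le, ← not_le, not_iff_not]
  constructor
  · intro hkj
    rw [shiftSeq_eq_of_mem_Icc ⟨hk.1, hkj⟩] at h
    rwa [← hu hk hm h]
  · intro hmj
    rw [← shiftSeq_eq_of_mem_Icc (n := n) (u := u) (q := q) ⟨hm.1, hmj⟩] at h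
    rwa [hq hk hm h]

lemma exists_shiftSeq_succ_eq (hu : Set.BijOn u (Set.Icc 1 n) N)
    (hq : Set.BijOn (shiftSeq n u q j) (Set.Icc 1 n) N) (hj : j + 1 ≤ n) :
    ∃ l, j < l ∧ l ≤ n ∧ Set.EqOn (shiftSeq n u q (j + 1))
      (shiftSeq n u q j ∘ shiftIndex j l) (Set.Icc 1 n) := by
  have hmem : j + 1 ∈ Set.Icc 1 n := ⟨Nat.le_add_left 1 j, hj⟩
  obtain ⟨l, hl, hlu⟩ := hq.surjOn (hu.mapsTo hmem)
  refine ⟨l, (lt_iff_lt_of_shiftSeq_eq hu.injOn hq.injOn hl hmem hlu).2 j.lt_succ_self, hl.2,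
    fun k hk => ?_⟩
  have hiff : (∃ i, k ≤ i ∧ i ≤ n ∧ shiftSeq n u q j i = u (j + 1)) ↔ k ≤ l := by
    refine ⟨fun ⟨i, hki, hin, hi⟩ => ?_, fun hkl => ⟨l, hkl, hl.2, hlu⟩⟩
    rwa [← hq.injOn ⟨hk.1.trans hki, hin⟩ hl (hi.trans hlu.symm)]
  simp only [shiftSeq, shiftIndex, hiff, Function.comp_apply]
  split_ifs
  exacts [rfl, hlu.symm, rfl, rfl]

lemma bijOn_shiftSeq (hu : Set.BijOn u (Set.Icc 1 n) N) (hq : Set.BijOn q (Set.Icc 1 n) N)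
    (hj : j ≤ n) : Set.BijOn (shiftSeq n u q j) (Set.Icc 1 n) N := by
  induction j with
  | zero => exact hq
  | succ j ih =>
    have hbij := ih (Nat.le_of_succ_le hj)
    obtain ⟨l, hjl, hln, heq⟩ := exists_shiftSeq_succ_eq hu hbij hj
    exact (hbij.comp (bijOn_shiftIndex hjl hln)).congr heq.symm

lemma antitoneOn_shiftSeq (hu : Set.BijOn u (Set.Icc 1 n) N) (hq : Set.BijOn q (Set.Icc 1 n) N)
    {f : ι → ℝ} (hf : AntitoneOn (fun k => f (q k)) (Set.Icc 1 n)) (hj : j ≤ n) :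
    AntitoneOn (fun k => f (shiftSeq n u q j k)) (Set.Ioc j n) := by
  induction j with
  | zero => exact hf
  | succ j ih =>
    have hjn := Nat.le_of_succ_le hj
    obtain ⟨l, _, _, heq⟩ := exists_shiftSeq_succ_eq hu (bijOn_shiftSeq hu hq hjn) hj
    have hmaps : Set.MapsTo (shiftIndex j l) (Set.Ioc (j + 1) n) (Set.Ioc j n) := fun k hk => by
      simp only [shiftIndex, Set.mem_Ioc] at *
      split_ifs <;> omega
    have hmono : MonotoneOn (shiftIndex j l) (Set.Ioc (j + 1) n) := fun k hk i hi hki => by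
      simp only [shiftIndex, Set.mem_Ioc] at *
      split_ifs <;> omega
    have hsub : Set.Ioc (j + 1) n ⊆ Set.Icc 1 n := fun k hk => ⟨by have := hk.1; omega, hk.2⟩
    intro k hk i hi hki
    simpa only [heq (hsub hk), heq (hsub hi), Function.comp_apply]
      using ih hjn (hmaps hk) (hmaps hi) (hmono hk hi hki)

end Shift

section Raising

variable {ι : Type*} {ρ : ℝ} {N : Finset ι} {a b f g : ι → ℝ} {u q : ℕ → ι} {j k t : ℕ}

open Classical in
/-- The values `b`, raised to `a` on the entries `u 1, ..., u j`. They are the branch values under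
`γ^j` if `b` and `a` are those under `s` and under the base scenario. -/
noncomputable def raiseTo (u : ℕ → ι) (a b : ι → ℝ) (j : ℕ) (v : ι) : ℝ :=
  if v ∈ u '' Set.Icc 1 j then a v else b v

lemma raiseTo_apply_of_le (hk : k ∈ Set.Icc 1 j) : raiseTo u a b j (u k) = a (u k) :=
  if_pos (Set.mem_image_of_mem u hk)

lemma raiseTo_apply_of_lt {n : ℕ} (hu : Set.InjOn u (Set.Icc 1 n)) (hk : k ∈ Set.Icc 1 n)
    (hjk : j < k) : raiseTo u a b j (u k) = b (u k) := by
  refine if_neg ?_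
  rintro ⟨i, hi, hik⟩
  have : i = k := hu ⟨hi.1, hi.2.trans (hjk.le.trans hk.2)⟩ hk hik
  exact hjk.not_ge (this ▸ hi.2)

lemma le_raiseTo {v : ι} (h : b v ≤ a v) : b v ≤ raiseTo u a b j v := by
  unfold raiseTo
  split_ifs
  exacts [h, le_rfl]

lemma raiseTo_mono {v : ι} (h : b v ≤ a v) (hjk : j ≤ k) :
    raiseTo u a b j v ≤ raiseTo u a b k v := by
  by_cases hv : v ∈ u '' Set.Icc 1 j
  · rw [raiseTo, raiseTo, if_pos hv, if_pos (Set.image_mono (Set.Icc_subset_Icc_right hjk) hv)]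
  · exact (if_neg hv).trans_le (le_raiseTo h)

lemma IsDecreasingListing.raiseTo_shiftSeq (hq : IsDecreasingListing N b q)
    (hu : IsDecreasingListing N a u) (hba : ∀ v ∈ N, b v ≤ a v) (hj : j ≤ N.card) :
    IsDecreasingListing N (raiseTo u a b j) (shiftSeq N.card u q j) := by
  have hbij := bijOn_shiftSeq hu.bijOn hq.bijOn hj
  have hraised : ∀ k ∈ Set.Icc 1 N.card, k ≤ j →
      raiseTo u a b j (shiftSeq N.card u q j k) = a (u k) := fun k hk hkj => by
    rw [shiftSeq_eq_of_mem_Icc ⟨hk.1, hkj⟩, raiseTo_apply_of_le ⟨hk.1, hkj⟩]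
  have hkept : ∀ k ∈ Set.Icc 1 N.card, j < k → ∃ m ∈ Set.Icc 1 N.card, j < m ∧
      shiftSeq N.card u q j k = u m ∧
      raiseTo u a b j (shiftSeq N.card u q j k) = b (u m) := fun k hk hjk => by
    obtain ⟨m, hm, heq⟩ := hu.bijOn.surjOn (hbij.mapsTo hk)
    have hjm := (lt_iff_lt_of_shiftSeq_eq hu.bijOn.injOn hbij.injOn hk hm heq.symm).1 hjk
    exact ⟨m, hm, hjm, heq.symm, by rw [← heq, raiseTo_apply_of_lt hu.bijOn.injOn hm hjm]⟩
  refine ⟨hbij, fun k hk i hi hki => ?_⟩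
  change raiseTo u a b j (shiftSeq N.card u q j i) ≤
    raiseTo u a b j (shiftSeq N.card u q j k)
  rcases le_or_gt i j with hij | hji
  · rw [hraised i hi hij, hraised k hk (hki.trans hij)]
    exact hu.antitoneOn hk hi hki
  · obtain ⟨m, hm, hjm, heq_i, hval_i⟩ := hkept i hi hji
    rw [hval_i]
    rcases le_or_gt k j with hkj | hjk
    · rw [hraised k hk hkj]
      exact (hba _ (hu.bijOn.mapsTo hm)).trans (hu.antitoneOn hk hm (hkj.trans hjm.le))
    · obtain ⟨l, _, _, heq_k, hval_k⟩ := hkept k hk hjk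
      rw [hval_k, ← heq_i, ← heq_k]
      exact antitoneOn_shiftSeq hu.bijOn hq.bijOn hq.antitoneOn hj ⟨hjk, hk.2⟩ ⟨hji, hi.2⟩ hki

/-- `τ` is the least position in the sequence `q 1, ..., q N.card` that attains the completion time
of the receivers in `N`: the notion `IsFirstCritical` for arbitrary values. -/
def IsFirstCriticalPosition (ρ : ℝ) (N : Finset ι) (f : ι → ℝ) (q : ℕ → ι) (τ : ℕ) : Prop :=
  IsLeast {k | k ∈ Set.Icc 1 N.card ∧ callTime ρ N f = k * ρ + f (q k)} τ

/-- None of the raised entries `u 1, ..., u j` attains the completion time. -/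
def NoRaisedCritical (ρ : ℝ) (N : Finset ι) (u : ℕ → ι) (a b : ι → ℝ) (j : ℕ) : Prop :=
  ∀ k ∈ Set.Icc 1 j, k * ρ + a (u k) < callTime ρ N (raiseTo u a b j)

lemma exists_isFirstCriticalPosition (hρ : 0 ≤ ρ) (hN : N.Nonempty) (hf : ∀ v ∈ N, 0 ≤ f v)
    (hq : IsDecreasingListing N f q) : ∃ τ, IsFirstCriticalPosition ρ N f q τ :=
  ⟨_, isLeast_csInf (hq.exists_callTime_eq hN hρ hf)⟩

section Listings

variable (hρ : 0 ≤ ρ) (hu : IsDecreasingListing N a u) (hba : ∀ v ∈ N, b v ≤ a v)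
include hρ hu hba

lemma NoRaisedCritical.succ (hq : IsDecreasingListing N b q) (hj : j + 1 ≤ N.card)
    (h : NoRaisedCritical ρ N u a b j)
    (hcrit : ¬ IsFirstCriticalPosition ρ N (raiseTo u a b (j + 1)) (shiftSeq N.card u q (j + 1))
      (j + 1)) : NoRaisedCritical ρ N u a b (j + 1) := by
  have hlist := hq.raiseTo_shiftSeq hu hba hj
  have hval : ∀ k ∈ Set.Icc 1 (j + 1),
      raiseTo u a b (j + 1) (shiftSeq N.card u q (j + 1) k) = a (u k) := fun k hk => by
    rw [shiftSeq_eq_of_mem_Icc hk, raiseTo_apply_of_le hk]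
  have hlt : ∀ k ∈ Set.Icc 1 j, k * ρ + a (u k) < callTime ρ N (raiseTo u a b (j + 1)) :=
    fun k hk => (h k hk).trans_le
      (callTime_mono hρ subset_rfl fun v hv => raiseTo_mono (hba v hv) j.le_succ)
  intro k hk
  rcases hk.2.eq_or_lt with rfl | hkj
  · refine lt_of_le_of_ne ?_ fun heq => hcrit ⟨⟨⟨hk.1, hj⟩, ?_⟩, fun i hi => ?_⟩
    · simpa only [hval _ hk] using hlist.mul_add_le_callTime hρ ⟨hk.1, hj⟩
    · rw [hval _ hk, heq]
    · by_contra! hij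
      have hi' : i ∈ Set.Icc 1 j := ⟨hi.1.1, Nat.lt_succ_iff.1 hij⟩
      exact (hlt i hi').ne' (hi.2.trans (by rw [hval i ⟨hi.1.1, hij.le⟩]))
  · exact hlt k ⟨hk.1, Nat.lt_succ_iff.1 hkj⟩

lemma noRaisedCritical_of_forall_not (hq : IsDecreasingListing N b q) (hj : j ≤ N.card)
    (h : ∀ i ∈ Set.Icc 1 j,
      ¬ IsFirstCriticalPosition ρ N (raiseTo u a b i) (shiftSeq N.card u q i) i) :
    NoRaisedCritical ρ N u a b j := by
  induction j with
  | zero => exact fun k hk => absurd hk (by simp)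
  | succ j ih =>
    exact (ih (Nat.le_of_succ_le hj) fun i hi => h i ⟨hi.1, hi.2.trans j.le_succ⟩).succ hρ hu hba
      hq hj (h _ ⟨Nat.le_add_left 1 j, le_rfl⟩)

lemma not_noRaisedCritical_card (hN : N.Nonempty) (hb : ∀ v ∈ N, 0 ≤ b v) :
    ¬ NoRaisedCritical ρ N u a b N.card := by
  intro h
  have hraise : ∀ v ∈ N, raiseTo u a b N.card v = a v := fun v hv => by
    obtain ⟨k, hk, rfl⟩ := hu.bijOn.surjOn hv
    exact raiseTo_apply_of_le hk
  obtain ⟨k, hk, hcall⟩ := hu.exists_callTime_eq hN hρ fun v hv => (hb v hv).trans (hba v hv)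
  exact (h k hk).ne (hcall.symm.trans (callTime_congr hρ hraise).symm)

lemma exists_isLeast_isFirstCriticalPosition (hq : IsDecreasingListing N b q) (hN : N.Nonempty)
    (hb : ∀ v ∈ N, 0 ≤ b v) :
    ∃ t, IsLeast {j | j ∈ Set.Icc 1 N.card ∧
      IsFirstCriticalPosition ρ N (raiseTo u a b j) (shiftSeq N.card u q j) j} t ∧
      ∀ j < t, NoRaisedCritical ρ N u a b j := by
  have hne : {j | j ∈ Set.Icc 1 N.card ∧
      IsFirstCriticalPosition ρ N (raiseTo u a b j) (shiftSeq N.card u q j) j}.Nonempty := by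
    by_contra hempty
    rw [Set.not_nonempty_iff_eq_empty, Set.eq_empty_iff_forall_notMem] at hempty
    exact not_noRaisedCritical_card hρ hu hba hN hb
      (noRaisedCritical_of_forall_not hρ hu hba hq le_rfl fun i hi hcrit => hempty i ⟨hi, hcrit⟩)
  have hleast := isLeast_csInf hne
  refine ⟨_, hleast, fun j hj => ?_⟩
  have hcard := hj.le.trans hleast.1.1.2
  exact noRaisedCritical_of_forall_not hρ hu hba hq hcard fun i hi hcrit =>
    (hi.2.trans_lt hj).not_ge (hleast.2 ⟨⟨hi.1, hi.2.trans hcard⟩, hcrit⟩)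

end Listings

/-- The completion time of the receivers in `N` is attained by those of value at least `φ`. -/
structure IsCriticalLevel (ρ : ℝ) (N : Finset ι) (f : ι → ℝ) (φ : ℝ) : Prop where
  nonempty : (N.filter fun v => φ ≤ f v).Nonempty
  callTime_le : callTime ρ N f ≤ ((N.filter fun v => φ ≤ f v).card : ℝ) * ρ + φ

lemma IsFirstCriticalPosition.isCriticalLevel (hρ : 0 ≤ ρ) (hq : IsDecreasingListing N f q)
    (h : IsFirstCriticalPosition ρ N f q t) : IsCriticalLevel ρ N f (f (q t)) := by
  refine ⟨⟨q t, Finset.mem_filter.2 ⟨hq.bijOn.mapsTo h.1.1, le_rfl⟩⟩, h.1.2.trans_le ?_⟩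
  gcongr
  exact (hq.le_apply_iff h.1.1 _).1 le_rfl

lemma IsCriticalLevel.card_mul_add_le {φ ψ : ℝ} {D : Finset ι} (hφ : IsCriticalLevel ρ N f φ)
    (hρ : 0 ≤ ρ) (hD : D ⊆ N) (hlt : ∀ v ∈ D, f v < φ) (hle : ∀ v ∈ D, ψ ≤ f v) (hψ : ψ ≤ φ) :
    D.card * ρ + ψ ≤ φ := by
  classical
  have hdisj : Disjoint D (N.filter fun v => φ ≤ f v) := Finset.disjoint_left.2 fun v hv hv' =>
    (hlt v hv).not_ge (Finset.mem_filter.1 hv').2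
  have hcall : ((D ∪ N.filter fun v => φ ≤ f v).card : ℝ) * ρ + ψ ≤ callTime ρ N f :=
    card_mul_add_le_callTime hρ (Finset.union_subset hD (Finset.filter_subset _ _))
      (hφ.nonempty.mono Finset.subset_union_right) fun v hv => (Finset.mem_union.1 hv).elim (hle v)
        fun h => hψ.trans (Finset.mem_filter.1 h).2
  rw [Finset.card_union_of_disjoint hdisj, Nat.cast_add, add_mul] at hcall
  linarith [hφ.callTime_le]

lemma IsCriticalLevel.exists_threshold {φ : ℝ} (hφ : IsCriticalLevel ρ N b φ) (hρ : 0 ≤ ρ)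
    (hb : ∀ v ∈ N, 0 ≤ b v) (hba : ∀ v ∈ N, b v ≤ a v)
    (hf : ∀ v ∈ N, f v = if φ ≤ a v then a v else b v) :
    ∃ θ, φ ≤ θ ∧ (N.filter fun v => θ ≤ a v).Nonempty ∧
      callTime ρ N f ≤ ((N.filter fun v => θ ≤ a v).card : ℝ) * ρ + θ := by
  classical
  have hbf : ∀ v ∈ N, b v ≤ f v ∧ f v ≤ a v := fun v hv => by
    rw [hf v hv]
    split_ifs
    exacts [⟨hba v hv, le_rfl⟩, ⟨le_rfl, hba v hv⟩]
  obtain ⟨v, hv, hcall⟩ := exists_callTime_eq (hφ.nonempty.mono (Finset.filter_subset _ _)) hρ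
    fun v hv => (hb v hv).trans (hbf v hv).1
  rw [hcall]
  by_cases hφv : φ ≤ a v
  · rw [hf v hv, if_pos hφv]
    refine ⟨a v, hφv, ⟨v, Finset.mem_filter.2 ⟨hv, le_rfl⟩⟩, ?_⟩
    gcongr with w hw
    exact (hbf w hw).2
  · rw [hf v hv, if_neg hφv]
    refine ⟨φ, le_rfl, hφ.nonempty.mono
      (Finset.monotone_filter_right N fun w hw h => h.trans (hba w hw)), ?_⟩
    have hlow := hφ.card_mul_add_le (D := N.filter fun w => b v ≤ b w ∧ a w < φ) hρ
      (Finset.filter_subset _ _)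
      (fun w hw => (hba w (Finset.mem_filter.1 hw).1).trans_lt (Finset.mem_filter.1 hw).2.2)
      (fun w hw => (Finset.mem_filter.1 hw).2.1) ((hba v hv).trans (not_le.1 hφv).le)
    have hsub : (N.filter fun w => b v ≤ f w) ⊆
        (N.filter fun w => φ ≤ a w) ∪ N.filter fun w => b v ≤ b w ∧ a w < φ := fun w hw => by
      obtain ⟨hwN, hvw⟩ := Finset.mem_filter.1 hw
      rw [hf w hwN] at hvw
      simp only [Finset.mem_union, Finset.mem_filter, hwN, true_and]
      split_ifs at hvw with hφw
      exacts [Or.inl hφw, Or.inr ⟨hvw, not_le.1 hφw⟩]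
    have hcard : ((N.filter fun w => b v ≤ f w).card : ℝ) ≤ (N.filter fun w => φ ≤ a w).card +
        (N.filter fun w => b v ≤ b w ∧ a w < φ).card :=
      mod_cast (Finset.card_le_card hsub).trans (Finset.card_union_le _ _)
    linarith [mul_le_mul_of_nonneg_right hcard hρ]

lemma IsCriticalLevel.le_apply_of_noRaisedCritical {φ : ℝ} (hφ : IsCriticalLevel ρ N b φ)
    (hρ : 0 ≤ ρ) (hb : ∀ v ∈ N, 0 ≤ b v) (hba : ∀ v ∈ N, b v ≤ a v)
    (hu : IsDecreasingListing N a u) (ht : t ∈ Set.Icc 1 N.card)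
    (h : ∀ j < t, NoRaisedCritical ρ N u a b j) : φ ≤ a (u t) := by
  rw [hu.le_apply_iff ht]
  by_contra! hlt
  have hraise : ∀ v ∈ N, raiseTo u a b (N.filter fun v => φ ≤ a v).card v =
      if φ ≤ a v then a v else b v := fun v hv => by
    obtain ⟨k, hk, rfl⟩ := hu.bijOn.surjOn hv
    split_ifs with hka <;> rw [hu.le_apply_iff hk] at hka
    exacts [raiseTo_apply_of_le ⟨hk.1, hka⟩,
      raiseTo_apply_of_lt hu.bijOn.injOn hk (not_le.1 hka)]
  obtain ⟨θ, hφθ, hne, hle⟩ := hφ.exists_threshold hρ hb hba hraise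
  have hk : (N.filter fun v => θ ≤ a v).card ∈ Set.Icc 1 N.card :=
    ⟨Finset.card_pos.2 hne, Finset.card_filter_le _ _⟩
  have hkφ : (N.filter fun v => θ ≤ a v).card ≤ (N.filter fun v => φ ≤ a v).card :=
    Finset.card_le_card (Finset.monotone_filter_right N fun v _ h => hφθ.trans h)
  have := h _ hlt _ ⟨hk.1, hkφ⟩
  linarith [(hu.le_apply_iff hk θ).2 le_rfl]

lemma IsCriticalLevel.card_mul_le_of_raised {φ θ : ℝ} (hφ : IsCriticalLevel ρ N f φ)
    (hρ : 0 ≤ ρ) (hfg : ∀ v ∈ N, f v ≤ g v) (hraised : ∀ v ∈ N, f v < g v → φ ≤ g v)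
    (hθ : θ < φ) :
    ((N.filter fun v => f v < θ ∧ θ ≤ g v).card : ℝ) * ρ ≤ callTime ρ N g - callTime ρ N f := by
  classical
  have hdisj : Disjoint (N.filter fun v => f v < θ ∧ θ ≤ g v) (N.filter fun v => φ ≤ f v) :=
    Finset.disjoint_filter.2 fun v _ hv hφv => (hv.1.trans hθ).not_ge hφv
  have hcall := card_mul_add_le_callTime (f := g) (θ := φ) hρ
    (Finset.union_subset (Finset.filter_subset (fun v => f v < θ ∧ θ ≤ g v) N)
      (Finset.filter_subset (fun v => φ ≤ f v) N))
    (hφ.nonempty.mono Finset.subset_union_right) fun v hv => by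
      rcases Finset.mem_union.1 hv with hv | hv <;> obtain ⟨hvN, hv⟩ := Finset.mem_filter.1 hv
      exacts [hraised v hvN (hv.1.trans_le hv.2), hv.trans (hfg v hvN)]
  rw [Finset.card_union_of_disjoint hdisj, Nat.cast_add, add_mul] at hcall
  linarith [hφ.callTime_le]

section Insert

variable [DecidableEq ι] {m : ι} {φ : ℝ} (hφ : IsCriticalLevel ρ N f φ) (hρ : 0 ≤ ρ) (hm : m ∉ N)
  (hgm : g m = f m) (hfg : ∀ v ∈ N, f v ≤ g v)
include hφ hρ

include hm in
lemma IsCriticalLevel.add_callTime_le_callTime_insert (h : φ ≤ f m) :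
    ρ + callTime ρ N f ≤ callTime ρ (insert m N) f := by
  have hcard := Finset.card_insert_of_notMem
    (fun hmem => hm (Finset.mem_filter.1 hmem).1 : m ∉ N.filter fun v => φ ≤ f v)
  have := card_mul_add_le_callTime (ρ := ρ) (f := f) (θ := φ) hρ
    (Finset.insert_subset_insert m (N.filter_subset fun v => φ ≤ f v))
    (Finset.insert_nonempty _ _) (by simpa using h)
  rw [hcard, Nat.cast_add_one, add_one_mul] at this
  linarith [hφ.callTime_le]

include hgm hfg

include hm in
lemma IsCriticalLevel.callTime_insert_le_of_le (h : φ ≤ f m) :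
    callTime ρ (insert m N) g ≤
      callTime ρ (insert m N) f + (callTime ρ N g - callTime ρ N f) := by
  have hinsert := callTime_insert_le (N := N) (f := g) (m := m) hρ
  have hN := hφ.add_callTime_le_callTime_insert hρ hm h
  have hm' := add_le_callTime (f := f) hρ (Finset.mem_insert_self m N)
  have hmono := callTime_mono hρ subset_rfl hfg
  rcases max_choice (g m) (callTime ρ N g) with hmax | hmax <;> linarith

lemma IsCriticalLevel.callTime_insert_le_of_lt (h : f m < φ)
    (hchanged : ∀ v ∈ N, f v < g v → φ ≤ g v) :
    callTime ρ (insert m N) g ≤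
      callTime ρ (insert m N) f + (callTime ρ N g - callTime ρ N f) := by
  have hsub := callTime_mono hρ (Finset.subset_insert m N) fun v _ => le_refl (f v)
  have hpos := callTime_nonneg (ρ := ρ) (N := N) (f := g)
  refine callTime_le_iff.2 ⟨by linarith, fun v hv => ?_⟩
  rcases lt_or_ge (f m) (g v) with hmv | hvm
  · have hfilter : ((insert m N).filter fun w => g v ≤ g w) = N.filter fun w => g v ≤ g w := by
      rw [Finset.filter_insert, if_neg (hgm.trans_lt hmv).not_ge]
    have hvN : v ∈ N := (Finset.mem_insert.1 hv).resolve_left fun hvm =>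
      hmv.ne' ((congrArg g hvm).trans hgm)
    have := (callTime_le_iff.1 (le_refl (callTime ρ N g))).2 v hvN
    rw [hfilter]
    linarith
  · have hraised := hφ.card_mul_le_of_raised hρ hfg hchanged (hvm.trans_lt h)
    have hkept := card_mul_add_le_callTime (f := f) hρ
      (Finset.filter_subset (fun w => g v ≤ f w) (insert m N)) ⟨m, by simpa using hvm⟩
      fun w hw => (Finset.mem_filter.1 hw).2
    have hcover : ((insert m N).filter fun w => g v ≤ g w) ⊆
        ((insert m N).filter fun w => g v ≤ f w) ∪ N.filter fun w => f w < g v ∧ g v ≤ g w := by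
      intro w hw
      obtain ⟨hw, hvw⟩ := Finset.mem_filter.1 hw
      rcases le_or_gt (g v) (f w) with hle | hlt
      · exact Finset.mem_union_left _ (Finset.mem_filter.2 ⟨hw, hle⟩)
      · have hwm : w ≠ m := by
          rintro rfl
          exact hlt.not_ge hvm
        exact Finset.mem_union_right _
          (Finset.mem_filter.2 ⟨(Finset.mem_insert.1 hw).resolve_left hwm, hlt, hvw⟩)
    have hcard : (((insert m N).filter fun w => g v ≤ g w).card : ℝ) ≤
        ((insert m N).filter fun w => g v ≤ f w).card +
          (N.filter fun w => f w < g v ∧ g v ≤ g w).card :=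
      mod_cast (Finset.card_le_card hcover).trans (Finset.card_union_le _ _)
    linarith [mul_le_mul_of_nonneg_right hcard hρ]

end Insert

end Raising

section Scenarios

variable {s lo hi : Weights G} {x y : V} {e : G.edgeSet}

lemma baseScenario_mem_scenarios (hlohi : lo ≤ hi) (x y : V) :
    baseScenario lo hi x y ∈ scenarios lo hi := by
  intro e
  rw [baseScenario]
  split_ifs
  · exact ⟨hlohi e, le_rfl⟩
  · exact ⟨le_rfl, hlohi e⟩

lemma betaScenario_mem_scenarios (hlohi : lo ≤ hi) (x y : V) (u : ℕ → V) (j : ℕ) :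
    betaScenario lo hi x y u j ∈ scenarios lo hi := by
  intro e
  rw [betaScenario]
  split_ifs
  · exact ⟨le_rfl, hlohi e⟩
  · exact baseScenario_mem_scenarios hlohi x y e

lemma gammaScenario_mem_scenarios (hlohi : lo ≤ hi) (hs : s ∈ scenarios lo hi) (x y : V)
    (u : ℕ → V) (j : ℕ) : gammaScenario lo hi s x y u j ∈ scenarios lo hi := by
  intro e
  rw [gammaScenario]
  split_ifs
  · exact baseScenario_mem_scenarios hlohi x y e
  · exact hs e

lemma baseScenario_of_mem_pathEdges (he : e ∈ pathEdges G x y) :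
    baseScenario lo hi x y e = hi e :=
  if_pos (Or.inl he)

lemma baseScenario_of_mem_edgesIn (he : e ∈ edgesIn G (closedBranch G y x)) :
    baseScenario lo hi x y e = hi e :=
  if_pos (Or.inr he)

lemma baseScenario_of_notMem_pathEdges (hpath : e ∉ pathEdges G x y)
    (he : e ∈ edgesIn G (openBranch G y x)) : baseScenario lo hi x y e = lo e := by
  obtain ⟨z, hz, -⟩ := exists_mem_edge_ne e y
  exact if_neg fun h => (h.resolve_left hpath) z hz (he z hz)

lemma betaScenario_branchDeg (lo hi : Weights G) (x y : V) (u : ℕ → V) :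
    betaScenario lo hi x y u (branchDeg G x y) = baseScenario lo hi x y := by
  funext e
  exact if_neg fun ⟨_, hlt, hle, _⟩ => hlt.not_ge hle

lemma IsParent.pathEdges_union_edgesIn_subset (hG : G.IsTree) {k : V}
    (h : IsParent G x y k) : pathEdges G x k ∪ edgesIn G (openBranch G k x) ⊆
      pathEdges G x y ∪ edgesIn G (openBranch G y x) := by
  refine Set.union_subset_union ?_
    (edgesIn_mono (Set.compl_subset_compl.1 (h.closedBranch_subset hG)))
  rw [h.pathEdges_eq_insert hG]
  exact Set.subset_insert _ _

lemma IsParent.eqOn_baseScenario (hG : G.IsTree) {k : V} (h : IsParent G x y k) :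
    (pathEdges G x k ∪ edgesIn G (openBranch G k x)).EqOn
      (baseScenario lo hi x y) (baseScenario lo hi x k) := by
  intro e he
  have hpath : e ∈ pathEdges G x y ↔ e = ⟨s(y, k), h.adj⟩ ∨ e ∈ pathEdges G x k := by
    rw [h.pathEdges_eq_insert hG, Set.mem_insert_iff]
  by_cases hek : e ∈ pathEdges G x k
  · rw [baseScenario_of_mem_pathEdges hek, baseScenario_of_mem_pathEdges (hpath.2 (.inr hek))]
  · have heo := he.resolve_left hek
    have hey : e ∉ pathEdges G x y := by
      rw [hpath, not_or]
      refine ⟨?_, hek⟩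
      rintro rfl
      exact mem_closedBranch_self k x (heo k (Sym2.mem_mk_right y k))
    rw [baseScenario_of_notMem_pathEdges hek heo, baseScenario_of_notMem_pathEdges hey
      ((edgesIn_mono (Set.compl_subset_compl.1 (h.closedBranch_subset hG))) heo)]

end Scenarios

section OpenBranch

variable {ρ : ℝ} {s s' lo hi : Weights G} [Finite V] (hG : G.IsTree) (hρ : 0 < ρ)
include hG hρ

lemma bTime_univ_le_add_pathWeight_sub (hs : 0 ≤ s) (hs' : 0 ≤ s') {x y : V} (a : V)
    (hpath : ∀ e ∈ pathEdges G x y, s e ≤ s' e) (hrest : ∀ e ∉ pathEdges G x y, s' e ≤ s e) :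
    bTime ρ s' a Set.univ ≤ bTime ρ s a Set.univ + (pathWeight s' x y - pathWeight s x y) := by
  have hδ : pathWeight s' x y - pathWeight s x y =
      ∑ᶠ e ∈ edgesIn G (closedBranch G a a), (pathEdges G x y).indicator (s' - s) e := by
    have huniv : edgesIn G (closedBranch G a a) = Set.univ :=
      Set.eq_univ_of_forall fun e z _ => by simp [closedBranch_self]
    rw [huniv, finsum_mem_univ, ← finsum_mem_def, pathWeight, pathWeight,
      ← finsum_mem_sub_distrib _ _ (Set.toFinite _)]
    rfl
  have hbound := bTime_le_bTime_add_finsum (a := a) (x := a) hG hρ hs' hs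
    (δ := (pathEdges G x y).indicator (s' - s))
    (Set.indicator_nonneg fun e he => sub_nonneg.2 (hpath e he)) fun e _ => by
      by_cases he : e ∈ pathEdges G x y
      · simp [he]
      · simpa [he] using hrest e he
  rwa [← hδ, closedBranch_self] at hbound

lemma bTime_closedBranch_congr (hs : 0 ≤ s) (hs' : 0 ≤ s') {x y m : V} (hm : IsParent G x y m)
    (h : (branchEdges G y m)ᶜ.EqOn s' s) :
    bTime ρ s' y (closedBranch G y x) = bTime ρ s y (closedBranch G y x) := by
  rw [bTime_closedBranch hG hρ hs, bTime_closedBranch hG hρ hs']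
  refine callTime_congr hρ.le fun v hv => ?_
  have hv := (mem_children_iff hG).1 hv
  refine branchValue_congr hG hρ hs' hs hv.adj.symm (h.mono ?_)
  refine (disjoint_branchEdges hG hv.adj.symm hm.adj ?_).subset_compl_right
  rintro rfl
  exact hv.notMem_closedBranch hG (hm.mem_closedBranch hG)

lemma isWorstCase_of_le_criterion (hlo : 0 ≤ lo) {x y : V} {R : ℝ}
    (hR : IsGreatest (regrets ρ lo hi x) R) (hs : s ∈ scenarios lo hi)
    (h : R ≤ criterion ρ s x y) : IsWorstCase ρ lo hi x s :=
  isWorstCase_of_le hR hs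
    (h.trans (criterion_le_regret hG hρ (nonneg_of_mem_scenarios hlo hs) x y))

lemma isCenter_of_le_criterion (hlo : 0 ≤ lo) {x y : V} {R : ℝ}
    (hR : IsGreatest (regrets ρ lo hi x) R) (hs : s ∈ scenarios lo hi)
    (h : R ≤ criterion ρ s x y) : IsCenter ρ s y := fun z =>
  sub_le_sub_iff_left _ |>.1 <| (hR.2 ⟨s, hs, z, rfl⟩).trans <|
    h.trans (criterion_le_regret hG hρ (nonneg_of_mem_scenarios hlo hs) x y)

theorem isWorstCase_and_isCenter_of_eqOn_baseScenario (hlo : 0 ≤ lo) (hlohi : lo ≤ hi) {x y : V}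
    (hs : IsWorstCase ρ lo hi x s) (hyx : y ≠ x) (hy : IsPrimeCenter ρ s y)
    (hbase : (pathEdges G x y ∪ edgesIn G (openBranch G y x)).EqOn s' (baseScenario lo hi x y))
    (hrest : (pathEdges G x y ∪ edgesIn G (openBranch G y x))ᶜ.EqOn s' s) :
    IsWorstCase ρ lo hi x s' ∧ IsCenter ρ s' y := by
  have hs' : s' ∈ scenarios lo hi := by
    intro e
    by_cases he : e ∈ pathEdges G x y ∪ edgesIn G (openBranch G y x)
    · rw [hbase he]
      exact baseScenario_mem_scenarios hlohi x y e
    · rw [hrest he]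
      exact hs.1 e
  have hs0 := nonneg_of_mem_scenarios hlo hs.1
  have hs0' := nonneg_of_mem_scenarios hlo hs'
  have hpath : ∀ e ∈ pathEdges G x y, s e ≤ s' e := fun e he => by
    rw [hbase (.inl he), baseScenario_of_mem_pathEdges he]
    exact (hs.1 e).2
  have hoff : ∀ e ∉ pathEdges G x y, s' e ≤ s e := fun e he => by
    by_cases heo : e ∈ edgesIn G (openBranch G y x)
    · rw [hbase (.inr heo), baseScenario_of_notMem_pathEdges he heo]
      exact (hs.1 e).1
    · exact (hrest (not_or_intro he heo)).le
  have hclosed : bTime ρ s' y (closedBranch G y x) = bTime ρ s y (closedBranch G y x) := by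
    obtain ⟨m, hm⟩ := exists_isParent hG hyx
    exact bTime_closedBranch_congr hG hρ hs0 hs0' hm (hm.pathEdges_union_edgesIn hG ▸ hrest)
  have hle : regret ρ s x y ≤ criterion ρ s' x y := by
    rw [← criterion_eq_regret hG hρ hs0 hyx hy, criterion, criterion, hclosed]
    linarith [bTime_univ_le_add_pathWeight_sub hG hρ hs0 hs0' y hpath hoff]
  have hR := hs.isGreatest hy.1
  exact ⟨isWorstCase_of_le_criterion hG hρ hlo hR hs' hle,
    isCenter_of_le_criterion hG hρ hlo hR hs' hle⟩

/-- Among the prime centers of worst-case scenarios take `y` farthest from `x`. Once the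
weights are those of its base scenario, there is a prime center at `y` or at the parent of `y`. -/
theorem exists_isPrimeCenter_and_eqOn_baseScenario (hlo : 0 ≤ lo) (hlohi : lo ≤ hi) {x : V}
    (hx : ∀ s, IsWorstCase ρ lo hi x s → ¬ IsPrimeCenter ρ s x) :
    ∃ s y, IsWorstCase ρ lo hi x s ∧ y ≠ x ∧ IsPrimeCenter ρ s y ∧
      (pathEdges G x y ∪ edgesIn G (openBranch G y x)).EqOn s (baseScenario lo hi x y) := by
  classical
  have hne : {y | ∃ s, IsWorstCase ρ lo hi x s ∧ IsPrimeCenter ρ s y}.Nonempty := by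
    obtain ⟨s, hs⟩ := exists_isWorstCase hG hρ hlo hlohi x
    obtain ⟨y, hy⟩ := exists_isPrimeCenter hG hρ (nonneg_of_mem_scenarios hlo hs.1)
    exact ⟨y, s, hs, hy⟩
  have hne_root : ∀ {s y}, IsWorstCase ρ lo hi x s → IsPrimeCenter ρ s y → y ≠ x := by
    rintro s y hs hy rfl
    exact hx s hs hy
  obtain ⟨y, ⟨s, hs, hy⟩, hfarthest⟩ :=
    Set.exists_max_image _ (G.dist x) (Set.toFinite _) hne
  set A := pathEdges G x y ∪ edgesIn G (openBranch G y x)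
  have hbase := Set.piecewise_eqOn A (baseScenario lo hi x y) s
  obtain ⟨hs', hy'⟩ := isWorstCase_and_isCenter_of_eqOn_baseScenario hG hρ hlo hlohi hs
    (hne_root hs hy) hy hbase (Set.piecewise_eqOn_compl A (baseScenario lo hi x y) s)
  obtain ⟨k, hk⟩ := exists_isPrimeCenter hG hρ (nonneg_of_mem_scenarios hlo hs'.1)
  refine ⟨_, k, hs', hne_root hs' hk, hk, ?_⟩
  rcases hy'.eq_or_adj hG hρ (nonneg_of_mem_scenarios hlo hs'.1) hk with rfl | hadj
  · exact hbase
  · have hparent : IsParent G x y k := by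
      refine (isParent_or_isParent_of_adj hG x hadj).resolve_left fun hchild => ?_
      have hdist := ((isParent_iff hG).1 hchild).2
      have hle := hfarthest k ⟨_, hs', hk⟩
      omega
    exact (hbase.mono (hparent.pathEdges_union_edgesIn_subset hG)).trans
      (hparent.eqOn_baseScenario hG)

end OpenBranch

section Branches

variable {ρ : ℝ} {s s' lo hi : Weights G} {x y m v : V} {u : ℕ → V} {j k : ℕ}

lemma IsParent.children_eq [Finite V] (h : IsParent G x y m) :
    children G x y = children G m y := by
  rw [← Finset.coe_inj, coe_children, coe_children, branchNbrs, branchNbrs, h.closedBranch_eq]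

lemma IsParent.notMem_children [Finite V] (hG : G.IsTree) (h : IsParent G x y m) :
    m ∉ children G x y := fun hm =>
  ((mem_children_iff hG).1 hm).notMem_closedBranch hG (h.mem_closedBranch hG)

lemma IsParent.pathEdges_subset_branchEdges (hG : G.IsTree) (h : IsParent G x y m) :
    pathEdges G x y ⊆ branchEdges G y m :=
  h.pathEdges_union_edgesIn hG ▸ Set.subset_union_left

lemma isSortedArrangement_iff [Finite V] : IsSortedArrangement ρ s x y u ↔
    IsDecreasingListing (children G x y) (branchValue ρ s y) u := by
  rw [IsSortedArrangement, ← card_children, ← coe_children]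
  exact ⟨fun h => ⟨h.1, h.2⟩, fun h => ⟨h.bijOn, h.antitoneOn⟩⟩

lemma IsSortedArrangement.isDecreasingListing [Finite V] (h : IsSortedArrangement ρ s x y u) :
    IsDecreasingListing (children G x y) (branchValue ρ s y) u :=
  isSortedArrangement_iff.1 h

lemma exists_isSortedArrangement [Finite V] (ρ : ℝ) (s : Weights G) (x y : V) :
    ∃ q, IsSortedArrangement ρ s x y q := by
  have : Nonempty V := ⟨y⟩
  simpa only [isSortedArrangement_iff] using exists_isDecreasingListing _ _

lemma eqOn_gammaScenario_of_le (hk : k ∈ Set.Icc 1 j) :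
    (branchEdges G y (u k)).EqOn (gammaScenario lo hi s x y u j) (baseScenario lo hi x y) :=
  fun _ he => if_pos ⟨k, hk.1, hk.2, he⟩

lemma eqOn_gammaScenario_of_notMem (hG : G.IsTree) (hv : G.Adj y v)
    (hu : ∀ k ∈ Set.Icc 1 j, G.Adj y (u k)) (h : v ∉ u '' Set.Icc 1 j) :
    (branchEdges G y v).EqOn (gammaScenario lo hi s x y u j) s := by
  refine fun e he => if_neg ?_
  rintro ⟨k, hk, hkj, hek⟩
  exact Set.disjoint_left.1 (disjoint_branchEdges hG hv (hu k ⟨hk, hkj⟩)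
    fun heq => h ⟨k, ⟨hk, hkj⟩, heq.symm⟩) he hek

lemma betaScenario_of_lt (hk : j < k) (hk' : k ≤ branchDeg G x y) {e : G.edgeSet}
    (he : e ∈ branchEdges G y (u k)) : betaScenario lo hi x y u j e = lo e :=
  if_pos ⟨k, hk, hk', he⟩

lemma eqOn_betaScenario_of_notMem (hG : G.IsTree) (hv : G.Adj y v)
    (hu : ∀ k ∈ Set.Ioc j (branchDeg G x y), G.Adj y (u k))
    (h : v ∉ u '' Set.Ioc j (branchDeg G x y)) :
    (branchEdges G y v).EqOn (betaScenario lo hi x y u j) (baseScenario lo hi x y) := by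
  refine fun e he => if_neg ?_
  rintro ⟨k, hk, hkj, hek⟩
  exact Set.disjoint_left.1 (disjoint_branchEdges hG hv (hu k ⟨hk, hkj⟩)
    fun heq => h ⟨k, ⟨hk, hkj⟩, heq.symm⟩) he hek

lemma IsParent.eqOn_gammaScenario (hG : G.IsTree) (hm : IsParent G x y m)
    (hu : IsSortedArrangement ρ s' x y u) (hj : j ≤ branchDeg G x y) :
    (branchEdges G y m).EqOn (gammaScenario lo hi s x y u j) s := by
  have hbranch : ∀ k ∈ Set.Icc 1 j, u k ∈ branchNbrs G x y := fun k hk =>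
    hu.1.mapsTo ⟨hk.1, hk.2.trans hj⟩
  refine eqOn_gammaScenario_of_notMem hG hm.adj (fun k hk => (hbranch k hk).1) ?_
  rintro ⟨k, hk, rfl⟩
  exact (hbranch k hk).2 hm.mem_openBranch

lemma IsParent.eqOn_betaScenario (hG : G.IsTree) (hm : IsParent G x y m)
    (hu : IsSortedArrangement ρ s' x y u) :
    (branchEdges G y m).EqOn (betaScenario lo hi x y u j) (baseScenario lo hi x y) := by
  have hbranch : ∀ k ∈ Set.Ioc j (branchDeg G x y), u k ∈ branchNbrs G x y := fun k hk =>
    hu.1.mapsTo ⟨Nat.one_le_of_lt hk.1, hk.2⟩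
  refine eqOn_betaScenario_of_notMem hG hm.adj (fun k hk => (hbranch k hk).1) ?_
  rintro ⟨k, hk, rfl⟩
  exact (hbranch k hk).2 hm.mem_openBranch

end Branches

section BranchValues

variable {ρ : ℝ} {s s' lo hi : Weights G} {x y m v : V} {u q : ℕ → V} {j τ : ℕ} [Finite V]
  (hG : G.IsTree) (hρ : 0 < ρ)
include hG hρ

lemma isFirstCritical_iff {f : V → ℝ} (hs : 0 ≤ s)
    (hf : Set.EqOn (branchValue ρ s y) f (children G x y))
    (hq : Set.MapsTo q (Set.Icc 1 (branchDeg G x y)) (branchNbrs G x y)) :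
    IsFirstCritical ρ s x y q τ ↔ IsFirstCriticalPosition ρ (children G x y) f q τ := by
  rw [IsFirstCritical, IsFirstCriticalPosition, bTime_closedBranch hG hρ hs,
    callTime_congr hρ.le hf, card_children]
  refine iff_of_eq (congrArg (IsLeast · τ) (Set.ext fun k => and_congr_right fun hk => ?_))
  have hmem := hq hk
  rw [← coe_children] at hmem
  rw [hf hmem]

lemma exists_isFirstCritical (hs : 0 ≤ s) (hN : (children G x y).Nonempty)
    (hq : IsSortedArrangement ρ s x y q) : ∃ τ, IsFirstCritical ρ s x y q τ := by
  simp only [isFirstCritical_iff hG hρ hs (fun _ _ => rfl) hq.1.mapsTo]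
  exact exists_isFirstCriticalPosition hρ.le hN (fun v _ => branchValue_nonneg hG hρ hs y v)
    hq.isDecreasingListing

lemma IsParent.criterion_eq_callTime [DecidableEq V] (hs : 0 ≤ s) (h : IsParent G x y m) :
    criterion ρ s x y = pathCost ρ s x y + callTime ρ (children G x y) (branchValue ρ s y) -
      callTime ρ (insert m (children G x y)) (branchValue ρ s y) := by
  rw [criterion_eq, bTime_closedBranch hG hρ hs, bTime_univ_eq_callTime_insert hG hρ hs h.adj,
    h.children_eq]

lemma IsParent.criterion_le_criterion [DecidableEq V] (hs : 0 ≤ s) (hs' : 0 ≤ s')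
    (h : IsParent G x y m) (hpath : (pathEdges G x y).EqOn s' s)
    (hcall : callTime ρ (insert m (children G x y)) (branchValue ρ s' y) ≤
      callTime ρ (insert m (children G x y)) (branchValue ρ s y) +
        (callTime ρ (children G x y) (branchValue ρ s' y) -
          callTime ρ (children G x y) (branchValue ρ s y))) :
    criterion ρ s x y ≤ criterion ρ s' x y := by
  have hcost : pathCost ρ s' x y = pathCost ρ s x y :=
    congrArg (_ + ·) (finsum_mem_congr rfl hpath)
  rw [h.criterion_eq_callTime hG hρ hs, h.criterion_eq_callTime hG hρ hs', hcost]
  linarith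

lemma IsPrimeCenter.children_nonempty (hs : 0 ≤ s) (hy : IsPrimeCenter ρ s y)
    (hx : ¬ IsPrimeCenter ρ s x) (hm : IsParent G x y m) : (children G x y).Nonempty := by
  by_contra hempty
  rw [Finset.not_nonempty_iff_eq_empty, hm.children_eq] at hempty
  have hzero : bTime ρ s y (closedBranch G y m) = 0 := by
    rw [bTime_closedBranch hG hρ hs, hempty]
    rfl
  have hnbr : ∀ v, G.Adj m v → v = y := by
    intro v hv
    by_contra hvy
    have hcall := add_le_callTime (f := branchValue ρ s m) hρ.le
      ((mem_children_iff_of_adj hG hm.adj.symm).2 ⟨hv, hvy⟩)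
    rw [← bTime_closedBranch hG hρ hs] at hcall
    linarith [hy.2 m hm.adj, branchValue_nonneg hG hρ hs m v]
  have hmx : m = x := by
    by_contra hne
    obtain ⟨t, ht⟩ := exists_isParent hG hne
    obtain rfl := hnbr t ht.adj
    exact hm.notMem_closedBranch hG (ht.mem_closedBranch hG)
  subst hmx
  refine hx (isPrimeCenter_of_forall_le hG hρ hs fun v hv => ?_)
  rw [hnbr v hv, hzero]
  exact bTime_nonneg hG hρ hs m y

variable (hlo : 0 ≤ lo) (hlohi : lo ≤ hi) (hs : s ∈ scenarios lo hi)
include hlo hlohi hs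

lemma branchValue_le_branchValue_baseScenario (hv : v ∈ children G x y) :
    branchValue ρ s y v ≤ branchValue ρ (baseScenario lo hi x y) y v := by
  have hv := (mem_children_iff hG).1 hv
  refine branchValue_mono hG hρ (nonneg_of_mem_scenarios hlo hs) (nonneg_of_mem_scenarios hlo
    (baseScenario_mem_scenarios hlohi x y)) hv.adj.symm fun e he => ?_
  rw [baseScenario_of_mem_edgesIn (hv.branchEdges_subset hG he)]
  exact (hs e).2

lemma branchValue_gammaScenario (hv : G.Adj y v) (hu : ∀ k ∈ Set.Icc 1 j, G.Adj y (u k)) :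
    branchValue ρ (gammaScenario lo hi s x y u j) y v =
      raiseTo u (branchValue ρ (baseScenario lo hi x y) y) (branchValue ρ s y) j v := by
  have hγ := nonneg_of_mem_scenarios hlo (gammaScenario_mem_scenarios hlohi hs x y u j)
  by_cases hmem : v ∈ u '' Set.Icc 1 j
  · rw [raiseTo, if_pos hmem]
    obtain ⟨k, hk, rfl⟩ := hmem
    exact branchValue_congr hG hρ hγ (nonneg_of_mem_scenarios hlo
      (baseScenario_mem_scenarios hlohi x y)) hv (eqOn_gammaScenario_of_le hk)
  · rw [raiseTo, if_neg hmem]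
    exact branchValue_congr hG hρ hγ (nonneg_of_mem_scenarios hlo hs) hv
      (eqOn_gammaScenario_of_notMem hG hv hu hmem)

omit hs in
lemma branchValue_betaScenario_of_le (hu : IsSortedArrangement ρ s' x y u)
    {k : ℕ} (hk : k ∈ Set.Icc 1 (branchDeg G x y)) (hkj : k ≤ j) :
    branchValue ρ (betaScenario lo hi x y u j) y (u k) =
      branchValue ρ (baseScenario lo hi x y) y (u k) := by
  refine branchValue_congr hG hρ
    (nonneg_of_mem_scenarios hlo (betaScenario_mem_scenarios hlohi x y u j))
    (nonneg_of_mem_scenarios hlo (baseScenario_mem_scenarios hlohi x y)) (hu.1.mapsTo hk).1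
    (eqOn_betaScenario_of_notMem hG (hu.1.mapsTo hk).1
      (fun i hi => (hu.1.mapsTo ⟨Nat.one_le_of_lt hi.1, hi.2⟩).1) ?_)
  rintro ⟨i, hi, hik⟩
  have hi_eq : i = k := hu.1.injOn ⟨Nat.one_le_of_lt hi.1, hi.2⟩ hk hik
  exact (hkj.trans_lt hi.1).ne' hi_eq

lemma branchValue_betaScenario_le_gammaScenario (hu : IsSortedArrangement ρ s' x y u)
    (hv : v ∈ children G x y) : branchValue ρ (betaScenario lo hi x y u j) y v ≤
      branchValue ρ (gammaScenario lo hi s x y u j) y v := by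
  have hγ := gammaScenario_mem_scenarios hlohi hs x y u j
  rw [← Finset.mem_coe, coe_children] at hv
  obtain ⟨k, hk, rfl⟩ := hu.1.surjOn hv
  rcases le_or_gt k j with hkj | hjk
  · rw [branchValue_betaScenario_of_le hG hρ hlo hlohi hu hk hkj]
    exact (branchValue_congr hG hρ (nonneg_of_mem_scenarios hlo hγ) (nonneg_of_mem_scenarios hlo
      (baseScenario_mem_scenarios hlohi x y)) hv.1 (eqOn_gammaScenario_of_le ⟨hk.1, hkj⟩)).ge
  · refine branchValue_mono hG hρ
      (nonneg_of_mem_scenarios hlo (betaScenario_mem_scenarios hlohi x y u j))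
      (nonneg_of_mem_scenarios hlo hγ) hv.1 fun e he => ?_
    rw [betaScenario_of_lt hjk hk.2 he]
    exact (hγ e).1

end BranchValues

lemma IsDecreasingListing.mul_add_le_callTime_of_le {ι : Type*} {ρ : ℝ} {N : Finset ι}
    {f g : ι → ℝ} {u : ℕ → ι} {t : ℕ} (hu : IsDecreasingListing N f u) (hρ : 0 ≤ ρ)
    (ht : t ∈ Set.Icc 1 N.card) (hfg : ∀ k ∈ Set.Icc 1 t, f (u k) ≤ g (u k)) :
    t * ρ + f (u t) ≤ callTime ρ N g := by
  classical
  have hsub : Set.Icc 1 t ⊆ Set.Icc 1 N.card := Set.Icc_subset_Icc_right ht.2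
  have hcard : ((Finset.Icc 1 t).image u).card = t := by
    rw [Finset.card_image_of_injOn (by simpa using hu.bijOn.injOn.mono hsub), Nat.card_Icc,
      Nat.add_sub_cancel]
  have hmem : ∀ v ∈ (Finset.Icc 1 t).image u, v ∈ N ∧ f (u t) ≤ g v := fun v hv => by
    obtain ⟨k, hk, rfl⟩ := Finset.mem_image.1 hv
    have hk := Finset.mem_Icc.1 hk
    exact ⟨hu.bijOn.mapsTo (hsub hk), (hu.antitoneOn (hsub hk) ht hk.2).trans (hfg k hk)⟩
  have hcall := card_mul_add_le_callTime (f := g) hρ (fun v hv => (hmem v hv).1)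
    ⟨u t, Finset.mem_image_of_mem u (Finset.mem_Icc.2 ⟨ht.1, le_rfl⟩)⟩ fun v hv => (hmem v hv).2
  rwa [hcard] at hcall

section ClosedBranch

variable {ρ : ℝ} {s lo hi : Weights G} {x y m : V} {u q : ℕ → V} {t : ℕ} {φ : ℝ} [Finite V]
  (hG : G.IsTree) (hρ : 0 < ρ) (hlo : 0 ≤ lo) (hlohi : lo ≤ hi) (hs : s ∈ scenarios lo hi)
  (hm : IsParent G x y m) (hbase : (branchEdges G y m).EqOn s (baseScenario lo hi x y))
  (hφ : IsCriticalLevel ρ (children G x y) (branchValue ρ s y) φ)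
  (hu : IsSortedArrangement ρ (baseScenario lo hi x y) x y u)
  (ht : IsFirstCritical ρ (gammaScenario lo hi s x y u t) x y
    (shiftSeq (branchDeg G x y) u q t) t)
include hG hρ hlo hlohi hs

include hu in
lemma exists_isLeast_isFirstCritical (hN : (children G x y).Nonempty)
    (hq : IsSortedArrangement ρ s x y q) :
    ∃ t, IsLeast {j | j ∈ Set.Icc 1 (branchDeg G x y) ∧
        IsFirstCritical ρ (gammaScenario lo hi s x y u j) x y
          (shiftSeq (branchDeg G x y) u q j) j} t ∧
      ∀ j < t, NoRaisedCritical ρ (children G x y) u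
        (branchValue ρ (baseScenario lo hi x y) y) (branchValue ρ s y) j := by
  have hs0 := nonneg_of_mem_scenarios hlo hs
  have hcritical : ∀ j ∈ Set.Icc 1 (branchDeg G x y),
      (IsFirstCritical ρ (gammaScenario lo hi s x y u j) x y
          (shiftSeq (branchDeg G x y) u q j) j ↔
        IsFirstCriticalPosition ρ (children G x y)
          (raiseTo u (branchValue ρ (baseScenario lo hi x y) y) (branchValue ρ s y) j)
          (shiftSeq (branchDeg G x y) u q j) j) := fun j hj =>
    isFirstCritical_iff hG hρ
      (nonneg_of_mem_scenarios hlo (gammaScenario_mem_scenarios hlohi hs x y u j))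
      (fun v hv => branchValue_gammaScenario hG hρ hlo hlohi hs
        ((mem_children_iff hG).1 hv).adj.symm
        fun k hk => (hu.1.mapsTo ⟨hk.1, hk.2.trans hj.2⟩).1)
      (bijOn_shiftSeq hu.1 hq.1 hj.2).mapsTo
  simp only [and_congr_right_iff.2 (hcritical _)]
  rw [← card_children]
  exact exists_isLeast_isFirstCriticalPosition hρ.le hu.isDecreasingListing
    (fun v hv => branchValue_le_branchValue_baseScenario hG hρ hlo hlohi hs hv)
    hq.isDecreasingListing hN fun v _ => branchValue_nonneg hG hρ hs0 y v

include hm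

include hbase hφ in
lemma criterion_le_criterion_baseScenario (hle : φ ≤ branchValue ρ s y m) :
    criterion ρ s x y ≤ criterion ρ (baseScenario lo hi x y) x y := by
  classical
  have hs0 := nonneg_of_mem_scenarios hlo hs
  have hα0 := nonneg_of_mem_scenarios hlo (baseScenario_mem_scenarios hlohi x y)
  refine hm.criterion_le_criterion hG hρ hs0 hα0
    (hbase.mono (hm.pathEdges_subset_branchEdges hG)).symm ?_
  exact hφ.callTime_insert_le_of_le hρ.le (hm.notMem_children hG)
    (branchValue_congr hG hρ hs0 hα0 hm.adj hbase).symm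
    (fun v hv => branchValue_le_branchValue_baseScenario hG hρ hlo hlohi hs hv) hle

include hφ hu in
lemma criterion_le_criterion_gammaScenario (hlt : branchValue ρ s y m < φ)
    (htN : t ∈ Set.Icc 1 (branchDeg G x y))
    (hφt : φ ≤ branchValue ρ (baseScenario lo hi x y) y (u t)) :
    criterion ρ s x y ≤ criterion ρ (gammaScenario lo hi s x y u t) x y := by
  classical
  have hs0 := nonneg_of_mem_scenarios hlo hs
  have hγ0 := nonneg_of_mem_scenarios hlo (gammaScenario_mem_scenarios hlohi hs x y u t)
  have hmEq := hm.eqOn_gammaScenario (lo := lo) (hi := hi) (s := s) hG hu htN.2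
  have hvalue : ∀ v ∈ children G x y, branchValue ρ (gammaScenario lo hi s x y u t) y v =
      raiseTo u (branchValue ρ (baseScenario lo hi x y) y) (branchValue ρ s y) t v := fun v hv =>
    branchValue_gammaScenario hG hρ hlo hlohi hs ((mem_children_iff hG).1 hv).adj.symm
      fun k hk => (hu.1.mapsTo ⟨hk.1, hk.2.trans htN.2⟩).1
  refine hm.criterion_le_criterion hG hρ hs0 hγ0
    (hmEq.mono (hm.pathEdges_subset_branchEdges hG)) ?_
  refine hφ.callTime_insert_le_of_lt hρ.le (branchValue_congr hG hρ hγ0 hs0 hm.adj hmEq)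
    (fun v hv => ?_) hlt fun v hv hchanged => ?_
  · rw [hvalue v hv]
    exact le_raiseTo (branchValue_le_branchValue_baseScenario hG hρ hlo hlohi hs hv)
  · rw [hvalue v hv] at hchanged ⊢
    by_cases hmem : v ∈ u '' Set.Icc 1 t
    · obtain ⟨k, hk, rfl⟩ := hmem
      rw [raiseTo_apply_of_le hk]
      exact hφt.trans (hu.2 ⟨hk.1, hk.2.trans htN.2⟩ htN hk.2)
    · exact absurd hchanged (if_neg hmem).not_gt

include hbase hu ht in
/-- The branches of `u 1, ..., u t` already force the time over the closed branch, so lowering the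
remaining ones does not affect it. -/
lemma criterion_gammaScenario_le_criterion_betaScenario :
    criterion ρ (gammaScenario lo hi s x y u t) x y ≤
      criterion ρ (betaScenario lo hi x y u t) x y := by
  classical
  have hγ0 := nonneg_of_mem_scenarios hlo (gammaScenario_mem_scenarios hlohi hs x y u t)
  have hβ0 := nonneg_of_mem_scenarios hlo (betaScenario_mem_scenarios hlohi x y u t)
  have htN := ht.1.1
  have hmEq : (branchEdges G y m).EqOn (betaScenario lo hi x y u t)
      (gammaScenario lo hi s x y u t) :=
    (hm.eqOn_betaScenario hG hu).trans (hbase.symm.trans (hm.eqOn_gammaScenario hG hu htN.2).symm)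
  have hclosed : callTime ρ (children G x y) (branchValue ρ (gammaScenario lo hi s x y u t) y) ≤
      callTime ρ (children G x y) (branchValue ρ (betaScenario lo hi x y u t) y) := by
    have hcrit := ht.1.2
    rw [bTime_closedBranch hG hρ hγ0, shiftSeq_eq_of_mem_Icc ⟨htN.1, le_rfl⟩,
      branchValue_congr hG hρ hγ0 (nonneg_of_mem_scenarios hlo
        (baseScenario_mem_scenarios hlohi x y)) (hu.1.mapsTo htN).1
        (eqOn_gammaScenario_of_le ⟨htN.1, le_rfl⟩)] at hcrit
    rw [hcrit]
    refine hu.isDecreasingListing.mul_add_le_callTime_of_le hρ.le (card_children x y ▸ htN)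
      fun k hk => ?_
    exact (branchValue_betaScenario_of_le hG hρ hlo hlohi hu ⟨hk.1, hk.2.trans htN.2⟩ hk.2).ge
  have htree : callTime ρ (insert m (children G x y))
        (branchValue ρ (betaScenario lo hi x y u t) y) ≤
      callTime ρ (insert m (children G x y))
        (branchValue ρ (gammaScenario lo hi s x y u t) y) := by
    refine callTime_mono hρ.le subset_rfl fun v hv => ?_
    rcases Finset.mem_insert.1 hv with rfl | hv
    · exact (branchValue_congr hG hρ hβ0 hγ0 hm.adj hmEq).le
    · exact branchValue_betaScenario_le_gammaScenario hG hρ hlo hlohi hs hu hv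
  refine hm.criterion_le_criterion hG hρ hγ0 hβ0
    (hmEq.mono (hm.pathEdges_subset_branchEdges hG)) ?_
  linarith

include hbase hu in
lemma exists_isFirstCritical_and_criterion_le (hy : IsPrimeCenter ρ s y)
    (hx : ¬ IsPrimeCenter ρ s x) (hq : IsSortedArrangement ρ s x y q) :
    ∃ τ, IsFirstCritical ρ s x y q τ ∧
      (branchValue ρ s y (q τ) ≤ branchValue ρ s y m →
        criterion ρ s x y ≤ criterion ρ (betaScenario lo hi x y u (branchDeg G x y)) x y) ∧
      (branchValue ρ s y m < branchValue ρ s y (q τ) →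
        ∃ t, IsLeast {j | j ∈ Set.Icc 1 (branchDeg G x y) ∧
            IsFirstCritical ρ (gammaScenario lo hi s x y u j) x y
              (shiftSeq (branchDeg G x y) u q j) j} t ∧
          criterion ρ s x y ≤ criterion ρ (betaScenario lo hi x y u t) x y) := by
  have hs0 := nonneg_of_mem_scenarios hlo hs
  have hN := hy.children_nonempty hG hρ hs0 hx hm
  obtain ⟨τ, hτ⟩ := exists_isFirstCritical hG hρ hs0 hN hq
  have hφ := ((isFirstCritical_iff hG hρ hs0 (fun _ _ => rfl) hq.1.mapsTo).1 hτ).isCriticalLevel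
    hρ.le hq.isDecreasingListing
  refine ⟨τ, hτ, fun hle => ?_, fun hlt => ?_⟩
  · rw [betaScenario_branchDeg]
    exact criterion_le_criterion_baseScenario hG hρ hlo hlohi hs hm hbase hφ hle
  · obtain ⟨t, ht, hbefore⟩ := exists_isLeast_isFirstCritical hG hρ hlo hlohi hs hu hN hq
    refine ⟨t, ht, le_trans ?_ (criterion_gammaScenario_le_criterion_betaScenario hG hρ hlo hlohi
      hs hm hbase hu ht.1.2)⟩
    refine criterion_le_criterion_gammaScenario hG hρ hlo hlohi hs hm hφ hu hlt ht.1.1 ?_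
    exact hφ.le_apply_of_noRaisedCritical hρ.le (fun v _ => branchValue_nonneg hG hρ hs0 y v)
      (fun v hv => branchValue_le_branchValue_baseScenario hG hρ hlo hlohi hs hv)
      hu.isDecreasingListing (card_children x y ▸ ht.1.1) hbefore

end ClosedBranch

section Candidates

variable {lo hi c : Weights G} {x : V} {u : V → ℕ → V}

/-- The pairs `(y, j)` that index the modified base scenarios `β^j_{x,y}`. -/
def candidateIndices (G : SimpleGraph V) (x : V) : Set (V × ℕ) :=
  {p | p.1 ≠ x ∧ p.2 ∈ Set.Icc 1 (branchDeg G x p.1)}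

lemma candidates_eq_insert_image (lo hi : Weights G) (x : V) (u : V → ℕ → V) (c : Weights G) :
    candidates lo hi x u c =
      insert c ((fun p : V × ℕ => betaScenario lo hi x p.1 (u p.1) p.2) ''
        candidateIndices G x) := by
  ext s
  refine or_congr_right ⟨?_, ?_⟩
  · rintro ⟨y, hy, j, hj, rfl⟩
    exact ⟨(y, j), ⟨hy, hj⟩, rfl⟩
  · rintro ⟨⟨y, j⟩, ⟨hy, hj⟩, rfl⟩
    exact ⟨y, hy, j, hj, rfl⟩

lemma candidates_subset_scenarios (hlohi : lo ≤ hi) (hc : c ∈ scenarios lo hi) (x : V)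
    (u : V → ℕ → V) : candidates lo hi x u c ⊆ scenarios lo hi := by
  rintro s (rfl | ⟨y, -, j, -, rfl⟩)
  exacts [hc, betaScenario_mem_scenarios hlohi x y (u y) j]

variable (hG : G.IsTree)
  (hu : ∀ y, y ≠ x → Set.BijOn (u y) (Set.Icc 1 (branchDeg G x y)) (branchNbrs G x y))
include hG hu

lemma isParent_of_mem_candidateIndices {p : V × ℕ} (hp : p ∈ candidateIndices G x) :
    IsParent G x (u p.1 p.2) p.1 :=
  (mem_branchNbrs_iff hG).1 ((hu p.1 hp.1).mapsTo hp.2)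

lemma injOn_candidateIndices :
    Set.InjOn (fun p : V × ℕ => u p.1 p.2) (candidateIndices G x) := by
  rintro ⟨y, j⟩ hp ⟨z, k⟩ hp' heq
  dsimp only at heq
  have hz := isParent_of_mem_candidateIndices hG hu hp'
  rw [← heq] at hz
  obtain rfl : y = z := (isParent_of_mem_candidateIndices hG hu hp).unique hG hz
  exact congrArg (y, ·) ((hu y hp.1).injOn hp.2 hp'.2 heq)

lemma mapsTo_candidateIndices {v : V} (hv : G.Adj x v) :
    Set.MapsTo (fun p : V × ℕ => u p.1 p.2) (candidateIndices G x) {x, v}ᶜ := by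
  intro p hp hmem
  have hparent := isParent_of_mem_candidateIndices hG hu hp
  dsimp only at hmem
  rcases hmem with hroot | hchild
  · exact hparent.ne_root hG hroot
  · rw [Set.mem_singleton_iff.1 hchild] at hparent
    exact hp.1 (hparent.unique hG (isParent_of_adj hG hv.symm))

variable [Finite V]

lemma finite_candidateIndices : (candidateIndices G x).Finite :=
  Set.Finite.of_injOn (Set.mapsTo_univ _ _) (injOn_candidateIndices hG hu) Set.finite_univ

lemma finite_candidates : (candidates lo hi x u c).Finite := by
  rw [candidates_eq_insert_image]
  exact ((finite_candidateIndices hG hu).image _).insert c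

lemma ncard_candidates_le (hV : 2 ≤ Nat.card V) :
    (candidates lo hi x u c).ncard ≤ Nat.card V - 1 := by
  have : Nontrivial V := Finite.one_lt_card_iff_nontrivial.1 hV
  obtain ⟨v, hv⟩ := hG.connected.preconnected.exists_adj_of_nontrivial x
  have hindices : (candidateIndices G x).ncard ≤ Nat.card V - 2 := by
    rw [← Set.ncard_pair hv.ne, ← Set.ncard_compl]
    exact Set.ncard_le_ncard_of_injOn _ (mapsTo_candidateIndices hG hu hv)
      (injOn_candidateIndices hG hu)
  have himage := Set.ncard_image_le (f := fun p : V × ℕ => betaScenario lo hi x p.1 (u p.1) p.2)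
    (finite_candidateIndices hG hu)
  have hinsert := Set.ncard_insert_le c
    ((fun p : V × ℕ => betaScenario lo hi x p.1 (u p.1) p.2) '' candidateIndices G x)
  rw [candidates_eq_insert_image]
  omega

end Candidates

section WorstCase

variable {ρ : ℝ} {s c lo hi : Weights G} {x y m : V} [Finite V] (hG : G.IsTree) (hρ : 0 < ρ)
  (hlo : 0 ≤ lo) (hlohi : lo ≤ hi)
include hG hρ hlo hlohi

theorem exists_isFirstCritical_and_isWorstCase {u q : ℕ → V} (hs : IsWorstCase ρ lo hi x s)
    (hy : IsPrimeCenter ρ s y) (hx : ¬ IsPrimeCenter ρ s x)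
    (hbase : (pathEdges G x y ∪ edgesIn G (openBranch G y x)).EqOn s (baseScenario lo hi x y))
    (hu : IsSortedArrangement ρ (baseScenario lo hi x y) x y u) (hm : IsParent G x y m)
    (hq : IsSortedArrangement ρ s x y q) :
    ∃ τ, IsFirstCritical ρ s x y q τ ∧
      (branchValue ρ s y (q τ) ≤ wt s y m + bTime ρ s m (openBranch G y x) →
        IsWorstCase ρ lo hi x (betaScenario lo hi x y u (branchDeg G x y))) ∧
      (wt s y m + bTime ρ s m (openBranch G y x) < branchValue ρ s y (q τ) →
        ∃ t, IsLeast {j | j ∈ Set.Icc 1 (branchDeg G x y) ∧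
            IsFirstCritical ρ (gammaScenario lo hi s x y u j) x y
              (shiftSeq (branchDeg G x y) u q j) j} t ∧
          IsWorstCase ρ lo hi x (betaScenario lo hi x y u t)) := by
  have hworst {s' : Weights G} (hs' : s' ∈ scenarios lo hi)
      (hle : criterion ρ s x y ≤ criterion ρ s' x y) : IsWorstCase ρ lo hi x s' :=
    isWorstCase_of_le_criterion hG hρ hlo (hs.isGreatest hy.1) hs'
      ((criterion_eq_regret hG hρ (nonneg_of_mem_scenarios hlo hs.1) (hm.ne_root hG) hy).ge.trans
        hle)
  have hβ := betaScenario_mem_scenarios hlohi x y u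
  rw [hm.pathEdges_union_edgesIn hG] at hbase
  rw [hm.openBranch_eq hG]
  obtain ⟨τ, hτ, hbranch, hparent⟩ := exists_isFirstCritical_and_criterion_le hG hρ hlo hlohi hs.1
    hm hbase hu hy hx hq
  refine ⟨τ, hτ, fun hle => hworst (hβ _) (hbranch hle), fun hlt => ?_⟩
  obtain ⟨t, ht, hle⟩ := hparent hlt
  exact ⟨t, ht, hworst (hβ t) hle⟩

variable {u : V → ℕ → V}
  (hu : ∀ y, y ≠ x → IsSortedArrangement ρ (baseScenario lo hi x y) x y (u y))
include hu

lemma exists_le_criterion_betaScenario {R : ℝ} (hR : IsGreatest (regrets ρ lo hi x) R)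
    (hx : ∀ s, IsWorstCase ρ lo hi x s → ¬ IsPrimeCenter ρ s x) :
    ∃ y, y ≠ x ∧ (∃ s, IsWorstCase ρ lo hi x s ∧ IsPrimeCenter ρ s y) ∧
      ∃ j ∈ Set.Icc 1 (branchDeg G x y),
        R ≤ criterion ρ (betaScenario lo hi x y (u y) j) x y := by
  obtain ⟨s, y, hs, hyx, hy, hbase⟩ := exists_isPrimeCenter_and_eqOn_baseScenario hG hρ hlo hlohi hx
  have hs0 := nonneg_of_mem_scenarios hlo hs.1
  refine ⟨y, hyx, ⟨s, hs, hy⟩, ?_⟩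
  rw [hR.unique (hs.isGreatest hy.1), ← criterion_eq_regret hG hρ hs0 hyx hy]
  obtain ⟨m, hm⟩ := exists_isParent hG hyx
  rw [hm.pathEdges_union_edgesIn hG] at hbase
  obtain ⟨q, hq⟩ := exists_isSortedArrangement ρ s x y
  obtain ⟨τ, hτ, hbranch, hparent⟩ := exists_isFirstCritical_and_criterion_le hG hρ hlo hlohi hs.1
    hm hbase (hu y hyx) hy (hx s hs) hq
  rcases le_or_gt (branchValue ρ s y (q τ)) (branchValue ρ s y m) with hle | hlt
  · exact ⟨_, ⟨hτ.1.1.1.trans hτ.1.1.2, le_rfl⟩, hbranch hle⟩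
  · obtain ⟨t, ht, hle⟩ := hparent hlt
    exact ⟨t, ht.1.1, hle⟩

lemma exists_isWorstCase_betaScenario
    (hx : ∀ s, IsWorstCase ρ lo hi x s → ¬ IsPrimeCenter ρ s x) :
    ∃ y, y ≠ x ∧ (∃ s, IsWorstCase ρ lo hi x s ∧ IsPrimeCenter ρ s y) ∧
      ∃ j ∈ Set.Icc 1 (branchDeg G x y),
        IsWorstCase ρ lo hi x (betaScenario lo hi x y (u y) j) := by
  obtain ⟨_, -, y, hR⟩ := exists_isWorstCase hG hρ hlo hlohi x
  obtain ⟨y, hyx, hy, j, hj, hle⟩ := exists_le_criterion_betaScenario hG hρ hlo hlohi hu hR hx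
  exact ⟨y, hyx, hy, j, hj, isWorstCase_of_le_criterion hG hρ hlo hR
    (betaScenario_mem_scenarios hlohi x y (u y) j) hle⟩

lemma exists_mem_candidates_isWorstCase (hc : c ∈ scenarios lo hi) :
    ∃ s ∈ candidates lo hi x u c, IsWorstCase ρ lo hi x s := by
  by_cases! hx : ∀ s, IsWorstCase ρ lo hi x s → ¬ IsPrimeCenter ρ s x
  · obtain ⟨y, hyx, -, j, hj, hworst⟩ :=
      exists_isWorstCase_betaScenario hG hρ hlo hlohi hu hx
    exact ⟨_, .inr ⟨y, hyx, j, hj, rfl⟩, hworst⟩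
  · obtain ⟨s, hs, hprime⟩ := hx
    exact ⟨c, .inl rfl, isWorstCase_of_isCenter hs hprime.1 hc⟩

lemma isWorstCase_of_forall_criterion_le (hs : s ∈ scenarios lo hi)
    (hmax : ∀ z, z ≠ x → ∀ j ∈ Set.Icc 1 (branchDeg G x z),
      criterion ρ (betaScenario lo hi x z (u z) j) x z ≤ criterion ρ s x y) :
    IsWorstCase ρ lo hi x s := by
  by_cases! hx : ∀ s, IsWorstCase ρ lo hi x s → ¬ IsPrimeCenter ρ s x
  · obtain ⟨_, -, z, hR⟩ := exists_isWorstCase hG hρ hlo hlohi x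
    obtain ⟨z, hzx, -, j, hj, hle⟩ := exists_le_criterion_betaScenario hG hρ hlo hlohi hu hR hx
    exact isWorstCase_of_le_criterion hG hρ hlo hR hs (hle.trans (hmax z hzx j hj))
  · obtain ⟨s', hs', hprime⟩ := hx
    exact isWorstCase_of_isCenter hs' hprime.1 hs

end WorstCase

end Broadcast

open Broadcast

theorem mainTheorem2 {V : Type*} [Fintype V] (G : SimpleGraph V) (hG : G.IsTree)
    (ρ : ℝ) (hρ : 0 < ρ) (lo hi : Weights G)
    (hlo : ∀ e, 0 ≤ lo e) (hlohi : ∀ e, lo e ≤ hi e) (x : V)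
    (c : Weights G) (hc : c ∈ scenarios lo hi)
    (u : V → ℕ → V)
    (hu : ∀ y, y ≠ x → IsSortedArrangement ρ (baseScenario lo hi x y) x y (u y)) :
    -- the finite family of candidate scenarios
    (candidates lo hi x u c ⊆ scenarios lo hi ∧
      (candidates lo hi x u c).Finite ∧
      (2 ≤ Fintype.card V → (candidates lo hi x u c).ncard ≤ Fintype.card V - 1) ∧
      (∃ s ∈ candidates lo hi x u c, IsWorstCase ρ lo hi x s)) ∧
    -- if `x` is optimal under some worst-case scenario, the arbitrary scenario is worst-case
    ((∃ s, IsWorstCase ρ lo hi x s ∧ IsCenter ρ s x) → IsWorstCase ρ lo hi x c) ∧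
    -- otherwise some modified base scenario is worst-case
    ((∀ s, IsWorstCase ρ lo hi x s → ¬ IsPrimeCenter ρ s x) →
      ∃ y, y ≠ x ∧ (∃ s, IsWorstCase ρ lo hi x s ∧ IsPrimeCenter ρ s y) ∧
        ∃ j ∈ Set.Icc 1 (branchDeg G x y),
          IsWorstCase ρ lo hi x (betaScenario lo hi x y (u y) j)) ∧
    -- every maximizer of the criterion is a worst-case scenario
    (∀ y', y' ≠ x → ∀ j' ∈ Set.Icc 1 (branchDeg G x y'),
      (∀ y, y ≠ x → ∀ j ∈ Set.Icc 1 (branchDeg G x y),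
        criterion ρ (betaScenario lo hi x y (u y) j) x y ≤
          criterion ρ (betaScenario lo hi x y' (u y') j') x y') →
      IsWorstCase ρ lo hi x (betaScenario lo hi x y' (u y') j')) ∧
    -- first transformation
    (∀ s y, IsWorstCase ρ lo hi x s → y ≠ x → IsPrimeCenter ρ s y →
      ∀ s' : Weights G,
        (∀ e ∈ pathEdges G x y ∪ edgesIn G (openBranch G y x),
          s' e = baseScenario lo hi x y e) →
        (∀ e, e ∉ pathEdges G x y ∪ edgesIn G (openBranch G y x) → s' e = s e) →
        IsWorstCase ρ lo hi x s' ∧ IsCenter ρ s' y) ∧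
    -- second transformation
    ((∀ s, IsWorstCase ρ lo hi x s → ¬ IsPrimeCenter ρ s x) →
      ∃ s y, IsWorstCase ρ lo hi x s ∧ y ≠ x ∧ IsPrimeCenter ρ s y ∧
        ∀ e ∈ pathEdges G x y ∪ edgesIn G (openBranch G y x),
          s e = baseScenario lo hi x y e) ∧
    -- third and fourth transformations
    ((∀ s, IsWorstCase ρ lo hi x s → ¬ IsPrimeCenter ρ s x) →
      ∀ s y, IsWorstCase ρ lo hi x s → IsPrimeCenter ρ s y →
        (∀ e ∈ pathEdges G x y ∪ edgesIn G (openBranch G y x),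
          s e = baseScenario lo hi x y e) →
        ∀ μ, G.Adj y μ → μ ∈ openBranch G y x →
        ∀ Q₀ : ℕ → V, IsSortedArrangement ρ s x y Q₀ →
        ∃ τ₀, IsFirstCritical ρ s x y Q₀ τ₀ ∧
          (branchValue ρ s y (Q₀ τ₀) ≤ wt s y μ + bTime ρ s μ (openBranch G y x) →
            IsWorstCase ρ lo hi x (betaScenario lo hi x y (u y) (branchDeg G x y))) ∧
          (wt s y μ + bTime ρ s μ (openBranch G y x) < branchValue ρ s y (Q₀ τ₀) →
            ∃ t, IsLeast {j | j ∈ Set.Icc 1 (branchDeg G x y) ∧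
                IsFirstCritical ρ (gammaScenario lo hi s x y (u y) j) x y
                  (shiftSeq (branchDeg G x y) (u y) Q₀ j) j} t ∧
              IsWorstCase ρ lo hi x (betaScenario lo hi x y (u y) t))) := by
  have hbij y hy := (hu y hy).1
  refine ⟨⟨candidates_subset_scenarios hlohi hc x u, finite_candidates hG hbij, ?_,
      exists_mem_candidates_isWorstCase hG hρ hlo hlohi hu hc⟩, ?_,
    exists_isWorstCase_betaScenario hG hρ hlo hlohi hu, ?_, ?_,
    exists_isPrimeCenter_and_eqOn_baseScenario hG hρ hlo hlohi, ?_⟩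
  · rw [← Nat.card_eq_fintype_card]
    exact ncard_candidates_le hG hbij
  · rintro ⟨s, hs, hx⟩
    exact isWorstCase_of_isCenter hs hx hc
  · intro y _ j _ hmax
    exact isWorstCase_of_forall_criterion_le hG hρ hlo hlohi hu
      (betaScenario_mem_scenarios hlohi x y (u y) j) hmax
  · intro s y hs hyx hy s' hbase hrest
    exact isWorstCase_and_isCenter_of_eqOn_baseScenario hG hρ hlo hlohi hs hyx hy hbase hrest
  · intro hx s y hs hy hbase μ hadj hμ Q₀ hQ
    have hm : IsParent G x y μ := ⟨hadj, hμ⟩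
    exact exists_isFirstCritical_and_isWorstCase hG hρ hlo hlohi hs hy (hx s hs) hbase
      (hu y (hm.ne_root hG)) hm hQ
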